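/- Let $\{X_t\}_{t\ge 1}$ be a time-homogeneous Markov chain on a measurable space $\mathcal X$ with transition kernel $\mathcal P$ and arbitrary initial distribution. Let $\tilde A:\mathcal X\to\mathbb R^{d\times d}$ and $\tilde b:\mathcal X\to\mathbb R^d$ be measurable. Assume: (A1) The chain is uniformly ergodic with (unique) stationary distribution $\mu$, i.e. $\mu\mathcal P=\mu$ and $\sup_{x\in\mathcal X}\|\mathcal P^t(x,\cdot)-\mu\|_{TV}\to 0$ as $t\to\infty$. (A2) (i) There are $\bar A\in\mathbb R^{d\times d}$ and $\bar b\in\mathbb R^d$ with $\bar A=\lim_{t\to\infty}\mathbb E[\tilde A(X_t)]$ and $\bar b=\lim_{t\to\infty}\mathbb E[\tilde b(X_t)]$; (ii) $\bar A$ is Hurwitz, i.e. all its eigenvalues have strictly negative real part (so $\bar A$ is invertible); (iii) $\sup_{x}\|\tilde A(x)\|_F<\infty$ and $\sup_x\|\tilde b(x)\|_2<\infty$. (A3) $\alpha_t=\alpha_0/t^{\eta}$ for $t\ge 1$, with $\alpha_0>0$ and $\eta\in(1/2,1)$. Let $\theta_*$ be the solution of $\bar A\theta=\bar b$. For deterministic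 initial values $\theta_0,\hat\theta_0\in\mathbb R^d$ define, for $t\ge 0$, $$\theta_{t+1}=\theta_t+\alpha_{t+1}\big(\tilde A(X_{t+1})\theta_t-\tilde b(X_{t+1})\big),\qquad \hat\theta_{t+1}=\hat\theta_t+\alpha_{t+1}W_{t+1}\big(\tilde A(X_{t+1})\hat\theta_t-\tilde b(X_{t+1})\big),$$ where $\{W_t\}_{t\ge 1}$ are bounded i.i.d. random variables with mean $1$ and variance $1$, independent of $\{X_t\}_{t\ge1}$. Put $\bar\theta_t=\frac1t\sum_{i=1}^t\theta_i$ and $\bar{\hat\theta}_t=\frac1t\sum_{i=1}^t\hat\theta_i$. Then, as $t\to\infty$, $$\sqrt t\,(\bar{\hat\theta}_t-\theta_*)=-\frac1{\sqrt t}\bar A^{-1}\sum_{i=1}^t W_{i+1}\big(\tilde A(X_{i+1})\theta_*-\tilde b(X_{i+1})\big)+o_p(1),$$ $$\sqrt t\,(\bar\theta_t-\theta_*)=-\frac1{\sqrt t}\bar A^{-1}\sum_{i=1}^t \big(\tilde A(X_{i+1})\theta_*-\tilde b(X_{i+1})\big)+o_p(1),$$ $$\sqrt t\,(\bar{\hat\theta}_t-\bar\theta_t)=-\frac1{\sqrt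 t}\bar A^{-1}\sum_{i=1}^t (W_{i+1}-1)\big(\tilde A(X_{i+1})\theta_*-\tilde b(X_{i+1})\big)+o_p(1),$$ where $o_p(1)$ denotes a sequence of random vectors converging to $0$ in probability. -/

import Mathlib

open MeasureTheory ProbabilityTheory Filter Topology
open scoped Matrix.Norms.Frobenius

noncomputable section

namespace LSA

/-- Total variation distance `sup_s |p s - q s|` (over measurable sets `s`) of two measures;
it is only used for probability measures. -/
def tvDist {S : Type*} [MeasurableSpace S] (p q : Measure S) : ℝ :=
  ⨆ s : {s : Set S // MeasurableSet s}, |p.real s.1 - q.real s.1|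

/-- The transition kernel `κ` is uniformly ergodic with stationary distribution `μ`:
`μ` is invariant and `sup_x ‖κ^t(x, ·) - μ‖_TV → 0` as `t → ∞`.
(Uniqueness of `μ` and the geometric rate are consequences.) -/
structure UniformlyErgodic {S : Type*} [MeasurableSpace S] (κ : Kernel S S) (μ : Measure S) :
    Prop where
  invariant : Kernel.Invariant κ μ
  tendsto : TendstoUniformly (fun (t : ℕ) (x : S) => tvDist ((κ ^ t) x) μ) (fun _ => 0) atTop

/-- The σ-algebra `σ(X_1, …, X_t)`. -/
abbrev history {Ω S : Type*} [MeasurableSpace S] (X : ℕ → Ω → S) (t : ℕ) : MeasurableSpace Ω :=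
  ⨆ i ∈ Finset.Icc 1 t, MeasurableSpace.comap (X i) inferInstance

/-- `(X_t)_{t ≥ 1}` is a time-homogeneous Markov chain under `P` with transition kernel `κ` and
arbitrary initial distribution: `P(X_{t+1} ∈ s | X_1, …, X_t) = κ(X_t, s)` almost surely.
The value `X 0` plays no role. -/
structure IsMarkovChain {Ω S : Type*} [MeasurableSpace Ω] [MeasurableSpace S]
    (P : Measure Ω) (κ : Kernel S S) (X : ℕ → Ω → S) : Prop where
  measurable : ∀ t, 1 ≤ t → Measurable (X t)
  markov : ∀ t, 1 ≤ t → ∀ s : Set S, MeasurableSet s →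
    P[(X (t + 1) ⁻¹' s).indicator (fun _ => (1 : ℝ)) | history X t]
      =ᵐ[P] fun ω => (κ (X t ω)).real s

/-- `(W_t)_{t ≥ 1}` are bootstrap weights: i.i.d., bounded, with mean one and variance one, and
independent of the observed chain `(X_t)_{t ≥ 1}`. The value `W 0` plays no role. -/
structure IsBootstrapWeights {Ω S : Type*} [MeasurableSpace Ω] [MeasurableSpace S]
    (P : Measure Ω) (X : ℕ → Ω → S) (W : ℕ → Ω → ℝ) : Prop where
  measurable : ∀ t, 1 ≤ t → Measurable (W t)
  indep : iIndepFun (fun t : ℕ => W (t + 1)) P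
  identDistrib : ∀ t, 1 ≤ t → IdentDistrib (W t) (W 1) P P
  bounded : ∃ Wmax : ℝ, ∀ᵐ ω ∂P, |W 1 ω| ≤ Wmax
  mean : ∫ ω, W 1 ω ∂P = 1
  variance : variance (W 1) P = 1
  indep_chain : IndepFun (fun ω (t : ℕ) => X (t + 1) ω) (fun ω (t : ℕ) => W (t + 1) ω) P

/-- A real square matrix is Hurwitz if all its complex eigenvalues have negative real part
(in particular it has full rank). -/
def IsHurwitz {d : ℕ} (A : Matrix (Fin d) (Fin d) ℝ) : Prop :=
  ∀ z : ℂ, Module.End.HasEigenvalue (Matrix.toLin' (A.map (algebraMap ℝ ℂ))) z → z.re < 0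

/-- The step sizes `α_t = α₀ / t ^ η`. -/
def stepSize (α₀ η : ℝ) (t : ℕ) : ℝ := α₀ / (t : ℝ) ^ η

/-- The linear stochastic approximation iterates
`θ_{t+1} = θ_t + α_{t+1} (A_{t+1} θ_t - b_{t+1})`, started from `θ₀`. -/
def lsa {d : ℕ} (α : ℕ → ℝ) (A : ℕ → Matrix (Fin d) (Fin d) ℝ)
    (b : ℕ → EuclideanSpace ℝ (Fin d)) (θ₀ : EuclideanSpace ℝ (Fin d)) :
    ℕ → EuclideanSpace ℝ (Fin d)
  | 0 => θ₀
  | t + 1 => lsa α A b θ₀ t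
      + α (t + 1) • (Matrix.toEuclideanLin (A (t + 1)) (lsa α A b θ₀ t) - b (t + 1))

/-- The perturbed linear stochastic approximation iterates
`θ_{t+1} = θ_t + α_{t+1} w_{t+1} (A_{t+1} θ_t - b_{t+1})`, started from `θ₀`. -/
def plsa {d : ℕ} (α : ℕ → ℝ) (w : ℕ → ℝ) (A : ℕ → Matrix (Fin d) (Fin d) ℝ)
    (b : ℕ → EuclideanSpace ℝ (Fin d)) (θ₀ : EuclideanSpace ℝ (Fin d)) :
    ℕ → EuclideanSpace ℝ (Fin d)
  | 0 => θ₀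
  | t + 1 => plsa α w A b θ₀ t
      + (α (t + 1) * w (t + 1)) •
        (Matrix.toEuclideanLin (A (t + 1)) (plsa α w A b θ₀ t) - b (t + 1))

/-- The Polyak–Ruppert average `(1/t) ∑_{i=1}^t θ_i`. -/
def average {d : ℕ} (θ : ℕ → EuclideanSpace ℝ (Fin d)) (t : ℕ) : EuclideanSpace ℝ (Fin d) :=
  (t : ℝ)⁻¹ • ∑ i ∈ Finset.Icc 1 t, θ i

/-- The linear term `-(1/√t) Ā⁻¹ ∑_{i=1}^t c_{i+1} (A_{i+1} θ - b_{i+1})`. -/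
def linearTerm {d : ℕ} (Abar : Matrix (Fin d) (Fin d) ℝ) (c : ℕ → ℝ)
    (A : ℕ → Matrix (Fin d) (Fin d) ℝ) (b : ℕ → EuclideanSpace ℝ (Fin d))
    (θ : EuclideanSpace ℝ (Fin d)) (t : ℕ) : EuclideanSpace ℝ (Fin d) :=
  -((Real.sqrt t)⁻¹ • Matrix.toEuclideanLin Abar⁻¹
      (∑ i ∈ Finset.Icc 1 t, c (i + 1) • (Matrix.toEuclideanLin (A (i + 1)) θ - b (i + 1))))

/-- `U_t = V_t + o_p(1)` as `t → ∞`: the difference converges to zero in probability. -/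
def EqUpToLittleOp {Ω : Type*} [MeasurableSpace Ω] {d : ℕ} (P : Measure Ω)
    (U V : ℕ → Ω → EuclideanSpace ℝ (Fin d)) : Prop :=
  TendstoInMeasure P (fun t ω => U t ω - V t ω) atTop (fun _ => 0)

end LSA

end

/-! Write `e_t = θ_t - θ*` and `ξ = Ã θ* - b̃`. Both recursions read `e_{t+1} = e_t + α_{t+1} (W A
e_t + W ξ)`, with `W = 1` in the unperturbed case, so one representation theorem,
`plsa_representation`, covers both. The third expansion is the difference of the first two, the
linear term being linear in the weights.

Uniform ergodicity gives the Poisson equation `f - μ f = g - κ g` a bounded solution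
(`exists_poisson`). With it, `W_{t+1} f(X_{t+1})` becomes its stationary mean plus a bounded
martingale difference plus a telescoping corrector `H_t - H_{t+1}` (`exists_noise_decomposition`).
This is applied to `Ã`, with mean `Ā`, and to `ξ`, with mean `Ā θ* - b̄ = 0`. Adding `α_t (H_t e_t +
h_t)` to `e_t` absorbs the correctors up to an error of order `α²(1 + ‖e‖)`. Since `Ā` is Hurwitz it
has a quadratic Lyapunov function, and a scalar recursion then gives `E‖e_t‖² = O(α_t)`, for the
corrected error and hence for the error itself.

Finally the corrected recursion is divided by `α_{t+1}` and summed (`sum_eq`). Up to the factor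
`Ā⁻¹/√t`, the sum of `Ā e_i + W_{i+1} ξ(X_{i+1})` is the difference to be shown negligible. It
equals an Abel-summed term of order `α_{t+1}^{-1/2}`, remainders of order `∑ α_i`, the martingale
sum of `M_i e_i` with second moment of order `∑ α_i`, and a bounded boundary term. All are `o(√t)`
in `L¹`: the first needs `η < 1`, the next two need `η > 1/2`. -/

namespace LSA

/-! ### Total variation, geometric ergodicity and the Poisson equation -/

section Poisson

variable {S F : Type*} [MeasurableSpace S] [NormedAddCommGroup F] [NormedSpace ℝ F]

lemma abs_measureReal_sub_le_tvDist (p q : Measure S) [IsProbabilityMeasure p]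
    [IsProbabilityMeasure q] {s : Set S} (hs : MeasurableSet s) :
    |p.real s - q.real s| ≤ tvDist p q := by
  refine le_ciSup (f := fun s : {s : Set S // MeasurableSet s} => |p.real s.1 - q.real s.1|)
    ⟨1, ?_⟩ ⟨s, hs⟩
  rintro _ ⟨t, rfl⟩
  have h1 := measureReal_le_one (μ := p) (s := t.1)
  have h2 := measureReal_le_one (μ := q) (s := t.1)
  have h3 := measureReal_nonneg (μ := p) (s := t.1)
  have h4 := measureReal_nonneg (μ := q) (s := t.1)
  exact abs_le.2 ⟨by linarith, by linarith⟩

/-- When `p ≤ q`, the difference `q - p` is a genuine measure, and its total mass is the bracket on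
the right. -/
lemma norm_integral_sub_le_of_le {p q : Measure S} [IsFiniteMeasure p] [IsFiniteMeasure q]
    (hle : p ≤ q) {f : S → F} (hf : StronglyMeasurable f) {K : ℝ} (hK : ∀ x, ‖f x‖ ≤ K) :
    ‖∫ x, f x ∂q - ∫ x, f x ∂p‖ ≤ K * (q.real Set.univ - p.real Set.univ) := by
  have hint : ∀ (ν : Measure S) [IsFiniteMeasure ν], Integrable f ν := fun ν _ =>
    Integrable.of_bound hf.aestronglyMeasurable K (ae_of_all _ hK)
  have hadd : q - p + p = q := Measure.sub_add_cancel_of_le hle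
  have h1 : ∫ x, f x ∂q = ∫ x, f x ∂(q - p) + ∫ x, f x ∂p := by
    conv_lhs => rw [← hadd]
    exact integral_add_measure (hint _) (hint _)
  have h2 : q.real Set.univ = (q - p).real Set.univ + p.real Set.univ := by
    conv_lhs => rw [← hadd]
    exact measureReal_add_apply
  rw [h1, h2, add_sub_cancel_right, add_sub_cancel_right]
  exact norm_integral_le_of_norm_le_const (ae_of_all _ hK)

/-- On each half of a Hahn decomposition the two measures are ordered and differ in mass by at most
the distance; the two halves give the factor 2. -/
lemma norm_integral_sub_le_tvDist (p q : Measure S) [IsProbabilityMeasure p]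
    [IsProbabilityMeasure q] {f : S → F} (hf : StronglyMeasurable f) {K : ℝ}
    (hK : ∀ x, ‖f x‖ ≤ K) :
    ‖∫ x, f x ∂p - ∫ x, f x ∂q‖ ≤ 2 * K * tvDist p q := by
  obtain ⟨s, hs⟩ := exists_isHahnDecomposition p q
  have hint : ∀ (ν : Measure S) [IsFiniteMeasure ν], Integrable f ν := fun ν _ =>
    Integrable.of_bound hf.aestronglyMeasurable K (ae_of_all _ hK)
  obtain ⟨x0⟩ : Nonempty S := p.nonempty_of_neZero
  have hK0 : 0 ≤ K := (norm_nonneg _).trans (hK x0)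
  have h1 := norm_integral_sub_le_of_le hs.le_on hf hK
  have h2 := norm_integral_sub_le_of_le hs.ge_on_compl hf hK
  simp only [measureReal_restrict_apply_univ] at h1 h2
  have h3 := abs_le.1 (abs_measureReal_sub_le_tvDist p q hs.measurableSet)
  have h4 := abs_le.1 (abs_measureReal_sub_le_tvDist p q hs.measurableSet.compl)
  rw [← integral_add_compl hs.measurableSet (hint p), ← integral_add_compl hs.measurableSet (hint q)]
  calc _ = ‖(∫ x in sᶜ, f x ∂p - ∫ x in sᶜ, f x ∂q) - (∫ x in s, f x ∂q - ∫ x in s, f x ∂p)‖ := by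
        congr 1; abel
    _ ≤ K * (p.real sᶜ - q.real sᶜ) + K * (q.real s - p.real s) :=
        (norm_sub_le _ _).trans (add_le_add h2 h1)
    _ ≤ K * tvDist p q + K * tvDist p q := by gcongr <;> linarith
    _ = _ := by ring

instance isMarkovKernel_pow (κ : Kernel S S) [IsMarkovKernel κ] (n : ℕ) :
    IsMarkovKernel (κ ^ n) := by
  induction n with
  | zero => rw [pow_zero]; exact inferInstanceAs (IsMarkovKernel (Kernel.id : Kernel S S))
  | succ n ih => rw [pow_succ]; exact inferInstanceAs (IsMarkovKernel ((κ ^ n) ∘ₖ κ))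

lemma invariant_pow {κ : Kernel S S} {μ : Measure S} (h : Kernel.Invariant κ μ) (n : ℕ) :
    Kernel.Invariant (κ ^ n) μ := by
  induction n with
  | zero => rw [pow_zero]; exact Measure.id_comp
  | succ n ih => rw [pow_succ]; exact ih.comp h

variable (κ : Kernel S S) [IsMarkovKernel κ]

lemma norm_integral_kernel_le {f : S → F} {K : ℝ} (hK : ∀ x, ‖f x‖ ≤ K) (x : S) :
    ‖∫ y, f y ∂κ x‖ ≤ K := by
  simpa using norm_integral_le_of_norm_le_const (μ := κ x) (ae_of_all _ hK)

lemma integral_kernel_pow_add {f : S → F} (hf : StronglyMeasurable f) {K : ℝ}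
    (hK : ∀ x, ‖f x‖ ≤ K) (m n : ℕ) (x : S) :
    ∫ y, f y ∂(κ ^ (m + n)) x = ∫ y, ∫ z, f z ∂(κ ^ m) y ∂(κ ^ n) x := by
  rw [Kernel.pow_add]
  exact Kernel.integral_comp (Integrable.of_bound hf.aestronglyMeasurable K (ae_of_all _ hK))

lemma integral_bind_kernel (μ : Measure S) [IsFiniteMeasure μ] {f : S → F}
    (hf : StronglyMeasurable f) {K : ℝ} (hK : ∀ x, ‖f x‖ ≤ K) :
    ∫ x, f x ∂(μ.bind κ) = ∫ x, ∫ y, f y ∂κ x ∂μ := by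
  have h := Kernel.integral_comp (κ := Kernel.const Unit μ) (η := κ) (a := ()) (f := f)
    (Integrable.of_bound hf.aestronglyMeasurable K (ae_of_all _ hK))
  rwa [← Measure.comp_eq_comp_const_apply] at h

lemma integral_integral_of_invariant {μ : Measure S} [IsProbabilityMeasure μ]
    (h : Kernel.Invariant κ μ) {f : S → F} (hf : StronglyMeasurable f) {K : ℝ}
    (hK : ∀ x, ‖f x‖ ≤ K) : ∫ x, ∫ y, f y ∂κ x ∂μ = ∫ x, f x ∂μ := by
  conv_rhs => rw [← h.def]
  exact (integral_bind_kernel κ μ hf hK).symm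

variable {κ}

/-- Once `κ^n₀` is uniformly within 1/4 of `μ`, it halves the sup norm of functions with `μ`-mean
zero, and by invariance the image again has mean zero. Iterating over blocks of length `n₀` gives
geometric decay. -/
lemma exists_summable_decay {μ : Measure S} [IsProbabilityMeasure μ]
    (hκ : UniformlyErgodic κ μ) :
    ∃ ρ : ℕ → ℝ, Summable ρ ∧ ∀ (f : S → F) (K : ℝ), StronglyMeasurable f → (∀ x, ‖f x‖ ≤ K) →
      ∫ x, f x ∂μ = 0 → ∀ n x, ‖∫ y, f y ∂(κ ^ n) x‖ ≤ K * ρ n := by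
  have hev := (Metric.tendstoUniformly_iff.1 hκ.tendsto (1 / 4) (by norm_num)).and
    (eventually_ge_atTop 1)
  obtain ⟨n₀, hn₀, hpos⟩ := hev.exists
  have htv : ∀ x, tvDist ((κ ^ n₀) x) μ ≤ 1 / 4 := fun x => by
    have := hn₀ x
    rw [dist_comm, Real.dist_eq, sub_zero] at this
    exact (le_abs_self _).trans this.le
  have hblock : ∀ k (f : S → F) (K : ℝ), StronglyMeasurable f → (∀ x, ‖f x‖ ≤ K) →
      ∫ x, f x ∂μ = 0 → ∀ x, ‖∫ y, f y ∂(κ ^ (n₀ * k)) x‖ ≤ K * (1 / 2) ^ k := by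
    intro k
    induction k with
    | zero =>
      intro f K hf hK _ x
      rw [mul_zero, pow_zero (1 / 2 : ℝ), mul_one]
      exact norm_integral_kernel_le (κ ^ 0) hK x
    | succ k ih =>
      intro f K hf hK h0 x
      rw [show n₀ * (k + 1) = n₀ + n₀ * k by ring, integral_kernel_pow_add κ hf hK]
      refine (ih (fun y => ∫ z, f z ∂(κ ^ n₀) y) (K / 2) hf.integral_kernel ?_ ?_ x).trans
        (le_of_eq (by ring))
      · intro y
        have h1 := norm_integral_sub_le_tvDist ((κ ^ n₀) y) μ hf hK
        rw [h0, sub_zero] at h1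
        have hK0 : 0 ≤ K := (norm_nonneg _).trans (hK y)
        nlinarith [htv y]
      · rw [integral_integral_of_invariant (κ ^ n₀) (invariant_pow hκ.invariant n₀) hf hK, h0]
  -- The rate per step is the `n₀`-th root of the rate per block. The factor 2 in the witness below
  -- pays for the incomplete last block, as `r ^ (n % n₀) ≥ 1/2`.
  set r : ℝ := (1 / 2 : ℝ) ^ ((n₀ : ℝ)⁻¹) with hr
  have hn0 : n₀ ≠ 0 := by omega
  have hrn : r ^ n₀ = 1 / 2 := Real.rpow_inv_natCast_pow (by norm_num) hn0
  have hr0 : 0 ≤ r := by positivity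
  have hr1 : r < 1 := Real.rpow_lt_one (by norm_num) (by norm_num) (by positivity)
  refine ⟨fun n => 2 * r ^ n, (summable_geometric_of_lt_one hr0 hr1).mul_left 2, ?_⟩
  intro f K hf hK h0 n x
  have hK0 : 0 ≤ K := (norm_nonneg _).trans (hK x)
  have h1 : ‖∫ y, f y ∂(κ ^ n) x‖ ≤ K * (1 / 2) ^ (n / n₀) := by
    conv_lhs => rw [← Nat.div_add_mod n n₀]
    rw [integral_kernel_pow_add κ hf hK]
    exact norm_integral_kernel_le _ (hblock _ f K hf hK h0) x
  refine h1.trans (mul_le_mul_of_nonneg_left ?_ hK0)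
  have h4 : r ^ n = (1 / 2) ^ (n / n₀) * r ^ (n % n₀) := by
    conv_lhs => rw [← Nat.div_add_mod n n₀]
    rw [pow_add, pow_mul, hrn]
  change _ ≤ 2 * r ^ n
  rw [h4]
  have h2 : 1 / 2 ≤ r ^ (n % n₀) := by
    rw [← hrn]
    exact pow_le_pow_of_le_one hr0 hr1.le (Nat.mod_lt _ (by omega)).le
  have h3 : (0 : ℝ) ≤ (1 / 2) ^ (n / n₀) := by positivity
  nlinarith

/-- The Poisson equation `g - κ g = f - μ f` of a uniformly ergodic kernel has a bounded
solution. -/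
theorem exists_poisson [CompleteSpace F] {μ : Measure S} [IsProbabilityMeasure μ]
    (hκ : UniformlyErgodic κ μ) {f : S → F} (hf : StronglyMeasurable f) {K : ℝ}
    (hK : ∀ x, ‖f x‖ ≤ K) :
    ∃ (g : S → F) (C : ℝ), StronglyMeasurable g ∧ (∀ x, ‖g x‖ ≤ C) ∧
      ∀ x, f x - ∫ y, f y ∂μ = g x - ∫ y, g y ∂κ x := by
  obtain ⟨ρ, hρ, hdecay⟩ := exists_summable_decay (F := F) hκ
  set c := ∫ y, f y ∂μ
  set f₀ : S → F := fun x => f x - c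
  have hf₀ : StronglyMeasurable f₀ := hf.sub stronglyMeasurable_const
  have hK₀ : ∀ x, ‖f₀ x‖ ≤ K + ‖c‖ := fun x => (norm_sub_le _ _).trans (by gcongr; exact hK x)
  have h0 : ∫ x, f₀ x ∂μ = 0 := by
    rw [integral_sub (Integrable.of_bound hf.aestronglyMeasurable K (ae_of_all _ hK))
      (integrable_const _)]
    simp [c]
  have hb := hdecay f₀ _ hf₀ hK₀ h0
  set T : ℕ → S → F := fun n x => ∫ y, f₀ y ∂(κ ^ n) x
  have hT : ∀ n, StronglyMeasurable (T n) := fun n => hf₀.integral_kernel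
  have hsum : Summable fun n => (K + ‖c‖) * ρ n := hρ.mul_left _
  have hTs : ∀ x, Summable fun n => T n x := fun x =>
    Summable.of_norm_bounded hsum fun n => hb n x
  have hT0 : ∀ x, T 0 x = f₀ x := fun x => by
    simp only [T, pow_zero]
    exact integral_dirac' _ _ hf₀
  have hTsucc : ∀ n x, ∫ y, T n y ∂κ x = T (n + 1) x := fun n x => by
    simp only [T]
    rw [integral_kernel_pow_add κ hf₀ hK₀, pow_one]
  -- The solution is the Neumann series `∑ κⁿ f₀`; applying `κ` shifts it by one, leaving only the
  -- term `f₀`.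
  refine ⟨fun x => ∑' n, T n x, ∑' n, (K + ‖c‖) * ρ n, ?_, fun x => ?_, fun x => ?_⟩
  · refine stronglyMeasurable_of_tendsto atTop
      (f := fun N x => ∑ n ∈ Finset.range N, T n x)
      (fun N => Finset.stronglyMeasurable_fun_sum _ fun n _ => hT n) ?_
    exact tendsto_pi_nhds.2 fun x => (hTs x).hasSum.tendsto_sum_nat
  · exact tsum_of_norm_bounded hsum.hasSum fun n => hb n x
  · have h1 : ∫ y, ∑' n, T n y ∂κ x = ∑' n, T (n + 1) x := by
      rw [← integral_tsum_of_summable_integral_norm]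
      · simp_rw [hTsucc]
      · exact fun n => Integrable.of_bound (hT n).aestronglyMeasurable _ (ae_of_all _ (hb n))
      · refine Summable.of_norm_bounded hsum fun n => ?_
        have := norm_integral_le_of_norm_le_const (μ := κ x) (f := fun y => ‖T n y‖)
          (C := (K + ‖c‖) * ρ n) (ae_of_all _ fun y => by simpa using hb n y)
        simpa using this
    change _ = ∑' n, T n x - _
    rw [h1, (hTs x).tsum_eq_zero_add, hT0, add_sub_cancel_right]

end Poisson

/-! ### Centred variables and enlargement of the conditioning σ-algebra -/

section Conditioning

variable {Ω F G : Type*} {mΩ : MeasurableSpace Ω} {P : Measure Ω} [IsProbabilityMeasure P]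
  [NormedAddCommGroup F] [NormedSpace ℝ F] [CompleteSpace F]
  [NormedAddCommGroup G] [NormedSpace ℝ G] [CompleteSpace G]

/-- The hypothesis `h0` says that `D` has conditional expectation zero given `m`, and an
`m`-measurable operator can be pulled out of the conditional expectation. -/
lemma integral_clm_apply_eq_zero {m : MeasurableSpace Ω} (hm : m ≤ mΩ) {D : Ω → F}
    (hD : Integrable D P) (h0 : ∀ s, MeasurableSet[m] s → ∫ ω in s, D ω ∂P = 0)
    {ψ : Ω → F →L[ℝ] G} (hψ : StronglyMeasurable[m] ψ)
    (hint : Integrable (fun ω => ψ ω (D ω)) P) : ∫ ω, ψ ω (D ω) ∂P = 0 := by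
  have h1 : (fun _ => (0 : F)) =ᵐ[P] P[D | m] :=
    ae_eq_condExp_of_forall_setIntegral_eq hm hD (fun s _ _ => integrableOn_zero)
      (fun s hs _ => by simp [h0 s hs]) stronglyMeasurable_const.aestronglyMeasurable
  have h2 := condExp_bilin_of_stronglyMeasurable_left (ContinuousLinearMap.id ℝ (F →L[ℝ] G))
    hψ hint hD
  have h3 := integral_condExp (μ := P) hm (f := fun ω => ψ ω (D ω))
  rw [← h3]
  refine integral_eq_zero_of_ae ?_
  filter_upwards [h1, h2] with ω h1 h2
  simp only [ContinuousLinearMap.id_apply] at h2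
  rw [h2, ← h1]
  simp

/-- These intersections form a π-system, which makes the join accessible to Dynkin's argument. -/
lemma sup_eq_generateFrom_inter (m₁ m₂ : MeasurableSpace Ω) :
    m₁ ⊔ m₂ = MeasurableSpace.generateFrom
      {s | ∃ a b, MeasurableSet[m₁] a ∧ MeasurableSet[m₂] b ∧ s = a ∩ b} := by
  apply le_antisymm
  · refine sup_le (fun a ha => ?_) (fun b hb => ?_)
    · exact MeasurableSpace.measurableSet_generateFrom ⟨a, Set.univ, ha, .univ, by simp⟩
    · exact MeasurableSpace.measurableSet_generateFrom ⟨Set.univ, b, .univ, hb, by simp⟩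
  · refine MeasurableSpace.generateFrom_le ?_
    rintro _ ⟨a, b, ha, hb, rfl⟩
    exact MeasurableSet.inter ((le_sup_left : m₁ ≤ m₁ ⊔ m₂) _ ha)
      ((le_sup_right : m₂ ≤ m₁ ⊔ m₂) _ hb)

/-- A random variable which integrates to zero on the sets of `m₁` does so on the sets of
`m₁ ⊔ m₂` when `m₂` is independent of it and of `m₁`. -/
lemma setIntegral_eq_zero_of_indep_sup {m₁ m₂ n₁ : MeasurableSpace Ω} (h1 : m₁ ≤ n₁)
    (hn : n₁ ≤ mΩ) (h2 : m₂ ≤ mΩ) (hind : Indep n₁ m₂ P) {D : Ω → F}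
    (hD : StronglyMeasurable[n₁] D) (hint : Integrable D P)
    (h0 : ∀ s, MeasurableSet[m₁] s → ∫ ω in s, D ω ∂P = 0) :
    ∀ s, MeasurableSet[m₁ ⊔ m₂] s → ∫ ω in s, D ω ∂P = 0 := by
  have hle : m₁ ⊔ m₂ ≤ mΩ := sup_le (h1.trans hn) h2
  have htot : ∫ ω, D ω ∂P = 0 := by simpa using h0 Set.univ .univ
  intro s hs
  induction s, hs using MeasurableSpace.induction_on_inter (sup_eq_generateFrom_inter m₁ m₂) with
  | h_inter =>
    rintro _ ⟨a, b, ha, hb, rfl⟩ _ ⟨a', b', ha', hb', rfl⟩ _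
    exact ⟨a ∩ a', b ∩ b', ha.inter ha', hb.inter hb', by ext; simp; tauto⟩
  | empty => simp
  | basic s hs =>
    obtain ⟨a, b, ha, hb, rfl⟩ := hs
    have ha' : MeasurableSet[mΩ] a := hn _ (h1 _ ha)
    -- `D` need not be `m₁`-measurable, so independence is used for `n₁`, which carries both `D` and
    -- `a`: given `m₂`, the variable `1_a D` has constant conditional expectation `∫_a D = 0`.
    have hc := condExp_indep_eq hn h2 (hD.indicator (h1 _ ha)) hind
    rw [Set.inter_comm, ← setIntegral_indicator ha',
      ← setIntegral_condExp h2 (hint.indicator ha') hb,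
      setIntegral_congr_ae (h2 _ hb) (hc.mono fun ω hω _ => hω), integral_indicator ha', h0 a ha]
    simp
  | compl s hs ih => rw [setIntegral_compl (hle _ hs) hint, htot, ih, sub_zero]
  | iUnion f hd hf ih =>
    rw [integral_iUnion (fun i => hle _ (hf i)) hd hint.integrableOn]
    simp [ih]

end Conditioning

/-! ### Filtrations and the Markov property -/

section Chain

variable {Ω S F : Type*} {mΩ : MeasurableSpace Ω} [MeasurableSpace S] {P : Measure Ω}
  [IsProbabilityMeasure P] [NormedAddCommGroup F] [NormedSpace ℝ F]

lemma history_le {X : ℕ → Ω → S} (hX : ∀ t, 1 ≤ t → Measurable (X t)) (t : ℕ) :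
    history X t ≤ mΩ :=
  iSup₂_le fun i hi => (hX i (Finset.mem_Icc.1 hi).1).comap_le

lemma history_mono (X : ℕ → Ω → S) : Monotone (history X) := fun _ _ hst =>
  iSup₂_le fun i hi => le_iSup₂_of_le i
    (Finset.mem_Icc.2 ⟨(Finset.mem_Icc.1 hi).1, (Finset.mem_Icc.1 hi).2.trans hst⟩) le_rfl

lemma measurable_history (X : ℕ → Ω → S) {t : ℕ} (ht : 1 ≤ t) : Measurable[history X t] (X t) :=
  measurable_iff_comap_le.2 <| le_iSup₂_of_le (f := fun i (_ : i ∈ Finset.Icc 1 t) =>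
    MeasurableSpace.comap (X i) inferInstance) t (Finset.mem_Icc.2 ⟨ht, le_rfl⟩) le_rfl

/-- The σ-algebra generated by the whole sequence from time one on. -/
abbrev fullHistory (X : ℕ → Ω → S) : MeasurableSpace Ω :=
  MeasurableSpace.comap (fun ω (t : ℕ) => X (t + 1) ω) inferInstance

lemma measurable_fullHistory (X : ℕ → Ω → S) {t : ℕ} (ht : 1 ≤ t) :
    Measurable[fullHistory X] (X t) := by
  obtain ⟨s, rfl⟩ := Nat.exists_eq_add_of_le' ht
  have h : Measurable fun f : ℕ → S => f s := measurable_pi_apply s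
  exact h.comp (comap_measurable _)

lemma history_le_fullHistory (X : ℕ → Ω → S) (t : ℕ) : history X t ≤ fullHistory X :=
  iSup₂_le fun _ hi => (measurable_fullHistory X (Finset.mem_Icc.1 hi).1).comap_le

lemma fullHistory_le {X : ℕ → Ω → S} (hX : ∀ t, 1 ≤ t → Measurable (X t)) :
    fullHistory X ≤ mΩ :=
  (measurable_pi_lambda _ fun t => hX (t + 1) (by omega)).comap_le

/-- The σ-algebra `σ(X_1, …, X_t, W_1, …, W_t)`. -/
abbrev jointHistory (X : ℕ → Ω → S) (W : ℕ → Ω → ℝ) (t : ℕ) : MeasurableSpace Ω :=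
  history X t ⊔ history W t

lemma jointHistory_mono (X : ℕ → Ω → S) (W : ℕ → Ω → ℝ) : Monotone (jointHistory X W) :=
  fun _ _ hst => sup_le_sup (history_mono X hst) (history_mono W hst)

variable {κ : Kernel S S} [IsMarkovKernel κ] {X : ℕ → Ω → S}

/-- The Markov property for indicators is integrated over `a` and recast as an identity of measures,
so that it applies at once to vector-valued integrands. -/
lemma IsMarkovChain.map_restrict (hX : IsMarkovChain P κ X) {t : ℕ} (ht : 1 ≤ t) {a : Set Ω}
    (ha : MeasurableSet[history X t] a) :
    (P.restrict a).map (X (t + 1)) = ((P.restrict a).map (X t)).bind κ := by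
  have hle := history_le hX.measurable t
  have hXt := hX.measurable t ht
  have hXs := hX.measurable (t + 1) (by omega)
  ext B hB
  have hκB : Measurable fun x => κ x B := κ.measurable_coe hB
  rw [Measure.map_apply hXs hB, Measure.bind_apply hB κ.aemeasurable, lintegral_map hκB hXt,
    Measure.restrict_apply (hXs hB)]
  have hfin : ∫⁻ ω in a, κ (X t ω) B ∂P ≠ ⊤ := by
    refine ne_top_of_le_ne_top (b := ∫⁻ _ in a, 1 ∂P) (by simp) (lintegral_mono fun ω => ?_)
    exact prob_le_one
  rw [← ENNReal.toReal_eq_toReal_iff' (measure_ne_top _ _) hfin]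
  have h1 : ∫ ω in a, (κ (X t ω)).real B ∂P = (∫⁻ ω in a, κ (X t ω) B ∂P).toReal :=
    integral_toReal (hκB.comp hXt).aemeasurable (ae_of_all _ fun ω => measure_lt_top _ _)
  have hint : Integrable ((X (t + 1) ⁻¹' B).indicator (fun _ => (1 : ℝ))) P :=
    (integrable_const _).indicator (hXs hB)
  rw [← h1, ← setIntegral_congr_ae (hle _ ha) ((hX.markov t ht B hB).mono fun ω h _ => h),
    setIntegral_condExp hle hint ha, integral_indicator_const _ (hXs hB)]
  simp [Measure.real, Measure.restrict_apply (hXs hB)]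

/-- This is the martingale difference property of the Poisson solution along the chain. -/
lemma IsMarkovChain.setIntegral_eq_zero (hX : IsMarkovChain P κ X) {g : S → F}
    (hg : StronglyMeasurable g) {C : ℝ} (hC : ∀ x, ‖g x‖ ≤ C) {t : ℕ} (ht : 1 ≤ t) {a : Set Ω}
    (ha : MeasurableSet[history X t] a) :
    ∫ ω in a, (g (X (t + 1) ω) - ∫ y, g y ∂κ (X t ω)) ∂P = 0 := by
  have hXt := hX.measurable t ht
  have hXs := hX.measurable (t + 1) (by omega)
  have hκg : StronglyMeasurable fun x => ∫ y, g y ∂κ x := hg.integral_kernel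
  have h1 : Integrable (fun ω => g (X (t + 1) ω)) (P.restrict a) :=
    Integrable.of_bound (hg.comp_measurable hXs).aestronglyMeasurable C (ae_of_all _ fun _ => hC _)
  have h2 : Integrable (fun ω => ∫ y, g y ∂κ (X t ω)) (P.restrict a) :=
    Integrable.of_bound (hκg.comp_measurable hXt).aestronglyMeasurable C
      (ae_of_all _ fun _ => norm_integral_kernel_le κ hC _)
  rw [integral_sub h1 h2, sub_eq_zero,
    ← integral_map hXs.aemeasurable hg.aestronglyMeasurable,
    ← integral_map hXt.aemeasurable hκg.aestronglyMeasurable, hX.map_restrict ht ha,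
    integral_bind_kernel κ _ hg hC]

/-- If the expectations along the chain converge, the limit is the stationary mean. -/
lemma IsMarkovChain.eq_integral_of_tendsto [CompleteSpace F] (hX : IsMarkovChain P κ X) {μ : Measure S}
    {f g : S → F} (hf : StronglyMeasurable f) {K : ℝ} (hK : ∀ x, ‖f x‖ ≤ K)
    (hg : StronglyMeasurable g) {C : ℝ} (hC : ∀ x, ‖g x‖ ≤ C)
    (hfg : ∀ x, f x - ∫ y, f y ∂μ = g x - ∫ y, g y ∂κ x)
    {c : F} (hc : Tendsto (fun t : ℕ => ∫ ω, f (X t ω) ∂P) atTop (𝓝 c)) :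
    ∫ y, f y ∂μ = c := by
  have hκg : StronglyMeasurable fun x => ∫ y, g y ∂κ x := hg.integral_kernel
  set u : ℕ → F := fun n => ∫ ω, g (X (n + 1) ω) ∂P with hu
  have hXm : ∀ n, Measurable (X (n + 1)) := fun n => hX.measurable (n + 1) (by omega)
  have hfi : ∀ n, Integrable (fun ω => f (X (n + 1) ω)) P := fun n =>
    Integrable.of_bound (hf.comp_measurable (hXm n)).aestronglyMeasurable K
      (ae_of_all _ fun _ => hK _)
  have hgi : ∀ n, Integrable (fun ω => g (X (n + 1) ω)) P := fun n =>
    Integrable.of_bound (hg.comp_measurable (hXm n)).aestronglyMeasurable C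
      (ae_of_all _ fun _ => hC _)
  have hκi : ∀ n, Integrable (fun ω => ∫ y, g y ∂κ (X (n + 1) ω)) P := fun n =>
    Integrable.of_bound (hκg.comp_measurable (hXm n)).aestronglyMeasurable C
      (ae_of_all _ fun _ => norm_integral_kernel_le κ hC _)
  have hstep : ∀ n, ∫ ω, f (X (n + 1) ω) ∂P - ∫ y, f y ∂μ = u n - u (n + 1) := by
    intro n
    have h1 : ∫ ω, (f (X (n + 1) ω) - ∫ y, f y ∂μ) ∂P
        = ∫ ω, f (X (n + 1) ω) ∂P - ∫ y, f y ∂μ := by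
      rw [integral_sub (hfi n) (integrable_const _)]; simp
    have h2 := hX.setIntegral_eq_zero hg hC (t := n + 1) (by omega) MeasurableSet.univ
    rw [setIntegral_univ, integral_sub (hgi (n + 1)) (hκi n), sub_eq_zero] at h2
    rw [← h1]
    simp_rw [hfg]
    rw [integral_sub (hgi n) (hκi n), ← h2]
  have hlim : Tendsto (fun n => u n - u (n + 1)) atTop (𝓝 (c - ∫ y, f y ∂μ)) := by
    simp_rw [← hstep]
    exact (hc.comp (tendsto_add_atTop_nat 1)).sub_const _
  -- The differences `u n - u (n + 1)` converge to `c - μ f`, hence so do their Cesàro means; but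
  -- these telescope and `u` is bounded, so they tend to 0.
  have hces := hlim.cesaro_smul
  have hbd : ∀ n, ‖u n‖ ≤ C := fun n => by
    simpa using norm_integral_le_of_norm_le_const (μ := P) (f := fun ω => g (X (n + 1) ω))
      (ae_of_all _ fun ω => hC _)
  have hzero : Tendsto (fun n : ℕ => (n⁻¹ : ℝ) • ∑ i ∈ Finset.range n, (u i - u (i + 1))) atTop
      (𝓝 0) := by
    simp_rw [Finset.sum_range_sub']
    refine squeeze_zero_norm (a := fun n : ℕ => (n⁻¹ : ℝ) * (C + C)) (fun n => ?_) ?_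
    · rw [norm_smul, norm_inv, RCLike.norm_natCast]
      gcongr
      exact (norm_sub_le _ _).trans (add_le_add (hbd _) (hbd _))
    · simpa using (tendsto_inv_atTop_nhds_zero_nat (𝕜 := ℝ)).mul_const (C + C)
  exact (sub_eq_zero.1 (tendsto_nhds_unique hces hzero)).symm

end Chain

/-! ### Bootstrap weights and the martingale decomposition of the noise -/

section Weights

variable {Ω S F : Type*} {mΩ : MeasurableSpace Ω} [MeasurableSpace S]

/-- Bounded weights, independent of the chain, with conditional mean one given the past weights. -/
structure IsMeanOneWeights (P : Measure Ω) (X : ℕ → Ω → S) (W : ℕ → Ω → ℝ) : Prop where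
  measurable : ∀ t, 1 ≤ t → Measurable (W t)
  bounded : ∃ K : ℝ, ∀ t, 1 ≤ t → ∀ᵐ ω ∂P, |W t ω| ≤ K
  indep_chain : IndepFun (fun ω (t : ℕ) => X (t + 1) ω) (fun ω (t : ℕ) => W (t + 1) ω) P
  mean : ∀ t, 1 ≤ t → ∀ s, MeasurableSet[history W t] s → ∫ ω in s, (W (t + 1) ω - 1) ∂P = 0

/-- Martingale differences `M t` (the increment from `t` to `t + 1`) and correctors `H t`, from
time one on, adapted to `𝓕` and bounded by `C`. -/
structure IsBoundedNoise [NormedAddCommGroup F] [NormedSpace ℝ F]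
    (P : Measure Ω) (𝓕 : ℕ → MeasurableSpace Ω) (C : ℝ) (M H : ℕ → Ω → F) : Prop where
  meas_corr : ∀ t, 1 ≤ t → StronglyMeasurable[𝓕 t] (H t)
  meas_mart : ∀ t, 1 ≤ t → StronglyMeasurable[𝓕 (t + 1)] (M t)
  bound_corr : ∀ t, 1 ≤ t → ∀ᵐ ω ∂P, ‖H t ω‖ ≤ C
  bound_mart : ∀ t, 1 ≤ t → ∀ᵐ ω ∂P, ‖M t ω‖ ≤ C
  centered : ∀ t, 1 ≤ t → ∀ s, MeasurableSet[𝓕 t] s → ∫ ω in s, M t ω ∂P = 0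

variable {P : Measure Ω} [IsProbabilityMeasure P] {X : ℕ → Ω → S} {W : ℕ → Ω → ℝ}

/-- Constant weights make the unperturbed recursion an instance of the perturbed one. -/
lemma isMeanOneWeights_one : IsMeanOneWeights P X (fun _ _ => 1) where
  measurable _ _ := measurable_const
  bounded := ⟨1, fun _ _ => by simp⟩
  indep_chain := indepFun_const_right _ _
  mean := by simp

/-- A weight is independent of the earlier ones, so its conditional mean is its mean; the bound
transfers by equality of laws. -/
lemma IsBootstrapWeights.isMeanOneWeights (hW : IsBootstrapWeights P X W) :
    IsMeanOneWeights P X W where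
  measurable := hW.measurable
  bounded := by
    obtain ⟨K, hK⟩ := hW.bounded
    refine ⟨K, fun t ht => ?_⟩
    exact (hW.identDistrib t ht).symm.ae_mem_snd (t := {x | |x| ≤ K})
      (measurableSet_le measurable_norm measurable_const) hK
  indep_chain := hW.indep_chain
  mean := by
    intro t ht s hs
    obtain ⟨K, hK⟩ := hW.bounded
    have hWm : ∀ t, Measurable (W (t + 1)) := fun t => hW.measurable (t + 1) (by omega)
    have hint1 : Integrable (W 1) P :=
      Integrable.of_bound (hW.measurable 1 le_rfl).aestronglyMeasurable K hK
    have hint : Integrable (W (t + 1)) P :=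
      (hW.identDistrib (t + 1) (by omega)).integrable_iff.2 hint1
    have hind : Indep (MeasurableSpace.comap (W (t + 1)) inferInstance) (history W t) P := by
      have h1 := indep_iSup_of_disjoint (fun i => (hWm i).comap_le) hW.indep
        (S := {t}) (T := {i | i < t}) (by simp)
      refine indep_of_indep_of_le_left (indep_of_indep_of_le_right h1 ?_) ?_
      · refine iSup₂_le fun i hi => ?_
        obtain ⟨j, rfl⟩ := Nat.exists_eq_add_of_le' (Finset.mem_Icc.1 hi).1
        have hj : j ∈ {i | i < t} := (Finset.mem_Icc.1 hi).2
        exact le_iSup₂_of_le (f := fun i (_ : i ∈ {i | i < t}) =>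
          MeasurableSpace.comap (W (i + 1)) inferInstance) j hj le_rfl
      · simp
    have hle := history_le hW.measurable t
    have hc := condExp_indep_eq (f := W (t + 1)) (hWm t).comap_le hle
      (comap_measurable (W (t + 1))).stronglyMeasurable hind
    rw [integral_sub hint.integrableOn (integrable_const _), ← setIntegral_condExp hle hint hs,
      setIntegral_congr_ae (hle _ hs) (hc.mono fun ω h _ => h),
      (hW.identDistrib (t + 1) (by omega)).integral_eq, hW.mean]
    simp

variable [NormedAddCommGroup F] [NormedSpace ℝ F] [CompleteSpace F]
  {κ : Kernel S S} [IsMarkovKernel κ] {μ : Measure S} [IsProbabilityMeasure μ]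

/-- Decomposition of weighted observations along the chain into their mean, a martingale
difference, and a telescoping corrector. -/
theorem exists_noise_decomposition (hκ : UniformlyErgodic κ μ) (hX : IsMarkovChain P κ X)
    (hW : IsMeanOneWeights P X W) {f : S → F} (hf : StronglyMeasurable f) {K : ℝ}
    (hK : ∀ x, ‖f x‖ ≤ K) {c : F} (hc : Tendsto (fun t : ℕ => ∫ ω, f (X t ω) ∂P) atTop (𝓝 c)) :
    ∃ (M H : ℕ → Ω → F) (C : ℝ), IsBoundedNoise P (jointHistory X W) C M H ∧
      ∀ t, 1 ≤ t → ∀ ω,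
        W (t + 1) ω • f (X (t + 1) ω) = c + M t ω + (H t ω - H (t + 1) ω) := by
  obtain ⟨g, C, hg, hC, hfg⟩ := exists_poisson hκ hf hK
  have hcμ := hX.eq_integral_of_tendsto hf hK hg hC hfg hc
  rw [hcμ] at hfg
  obtain ⟨B, hB⟩ := hW.bounded
  set h : S → F := fun x => ∫ y, g y ∂κ x with hh
  have hhm : StronglyMeasurable h := hg.integral_kernel
  have hhC : ∀ x, ‖h x‖ ≤ C := norm_integral_kernel_le κ hC
  have hXF : ∀ t, 1 ≤ t → Measurable[jointHistory X W t] (X t) := fun t ht =>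
    (measurable_history X ht).mono le_sup_left le_rfl
  have hWF : ∀ t, 1 ≤ t → Measurable[jointHistory X W t] (W t) := fun t ht =>
    (measurable_history W ht).mono le_sup_right le_rfl
  have hXle := fullHistory_le hX.measurable
  have hWle := fullHistory_le hW.measurable
  have hind : Indep (fullHistory X) (fullHistory W) P := hW.indep_chain
  -- From `W f = f + (W - 1) f` and the Poisson equation at `X_{t+1}`, add and subtract `κ g (X_t)`.
  -- The weights enter only the martingale part; the corrector depends on the chain alone.
  refine ⟨fun t ω => (W (t + 1) ω - 1) • f (X (t + 1) ω) + (g (X (t + 1) ω) - h (X t ω)),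
    fun t ω => h (X t ω), C + ((B + 1) * K + (C + C)), ⟨?_, ?_, ?_, ?_, ?_⟩, ?_⟩
  · exact fun t ht => hhm.comp_measurable (hXF t ht)
  · intro t ht
    have hX' := hXF (t + 1) (by omega)
    have hW' := (hWF (t + 1) (by omega)).stronglyMeasurable
    exact ((hW'.sub stronglyMeasurable_const).smul (hf.comp_measurable hX')).add
      ((hg.comp_measurable hX').sub
        ((hhm.comp_measurable (hXF t ht)).mono (jointHistory_mono X W (by omega))))
  · intro t ht
    -- The bound on `W 1` serves only to give `0 ≤ B`.
    filter_upwards [hB 1 le_rfl] with ω hω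
    have hC0 := (norm_nonneg _).trans (hC (X t ω))
    have hK0 := (norm_nonneg _).trans (hK (X t ω))
    have hB0 := (abs_nonneg _).trans hω
    have := hhC (X t ω)
    nlinarith
  · intro t ht
    filter_upwards [hB (t + 1) (by omega)] with ω hω
    have hC0 := (norm_nonneg _).trans (hC (X t ω))
    have hB0 := (abs_nonneg _).trans hω
    have h1 : ‖(W (t + 1) ω - 1) • f (X (t + 1) ω)‖ ≤ (B + 1) * K := by
      rw [norm_smul]
      gcongr
      · exact (norm_sub_le _ _).trans (by simpa using hω)
      · exact hK _
    have h2 : ‖g (X (t + 1) ω) - h (X t ω)‖ ≤ C + C :=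
      (norm_sub_le _ _).trans (add_le_add (hC _) (hhC _))
    have := norm_add_le ((W (t + 1) ω - 1) • f (X (t + 1) ω)) (g (X (t + 1) ω) - h (X t ω))
    linarith
  · intro t ht s hs
    have hle : jointHistory X W t ≤ mΩ :=
      sup_le (history_le hX.measurable t) (history_le hW.measurable t)
    have hXt := hX.measurable t ht
    have hXs := hX.measurable (t + 1) (by omega)
    have hWs := hW.measurable (t + 1) (by omega)
    have hDi : Integrable (fun ω => W (t + 1) ω - 1) P :=
      Integrable.of_bound (hWs.sub measurable_const).aestronglyMeasurable (B + 1) (by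
        filter_upwards [hB (t + 1) (by omega)] with ω hω
        exact (norm_sub_le _ _).trans (by simpa using hω))
    have hfm : StronglyMeasurable[fullHistory X] fun ω => f (X (t + 1) ω) :=
      hf.comp_measurable (measurable_fullHistory X (by omega))
    have hi1 : Integrable (fun ω => (W (t + 1) ω - 1) • f (X (t + 1) ω)) P :=
      hDi.smul_bdd K (hfm.mono hXle).aestronglyMeasurable (ae_of_all _ fun _ => hK _)
    have hgm : StronglyMeasurable[fullHistory X] fun ω => g (X (t + 1) ω) - h (X t ω) :=
      (hg.comp_measurable (measurable_fullHistory X (by omega))).sub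
        (hhm.comp_measurable (measurable_fullHistory X ht))
    have hi2 : Integrable (fun ω => g (X (t + 1) ω) - h (X t ω)) P :=
      Integrable.of_bound (hgm.mono hXle).aestronglyMeasurable (C + C) (ae_of_all _ fun _ =>
        (norm_sub_le _ _).trans (add_le_add (hC _) (hhC _)))
    rw [integral_add hi1.integrableOn hi2.integrableOn]
    -- The chain part is centred given the past of the chain; adjoining the past weights, which are
    -- independent of the whole chain, changes nothing.
    have hchain := setIntegral_eq_zero_of_indep_sup (history_le_fullHistory X t) hXle
      (history_le hW.measurable t)
      (indep_of_indep_of_le_right hind (history_le_fullHistory W t)) hgm hi2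
      (fun a ha => hX.setIntegral_eq_zero hg hC ht ha) s hs
    rw [hchain, add_zero]
    -- Here the whole chain is adjoined to the past weights, so that `f (X (t + 1))` becomes
    -- measurable for the conditioning σ-algebra and can be pulled out.
    have hweights := setIntegral_eq_zero_of_indep_sup (history_le_fullHistory W t) hWle hXle
      hind.symm
      ((measurable_fullHistory W (by omega)).sub measurable_const).stronglyMeasurable hDi
      (hW.mean t ht)
    have hle' : history W t ⊔ fullHistory X ≤ mΩ := sup_le (history_le hW.measurable t) hXle
    have hs' : MeasurableSet[history W t ⊔ fullHistory X] s :=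
      (sup_le (le_sup_of_le_right (history_le_fullHistory X t)) le_sup_left :
        jointHistory X W t ≤ history W t ⊔ fullHistory X) _ hs
    have hψ : StronglyMeasurable[history W t ⊔ fullHistory X] fun ω =>
        ContinuousLinearMap.toSpanSingleton ℝ (s.indicator (fun ω => f (X (t + 1) ω)) ω) :=
      (ContinuousLinearMap.toSpanSingletonCLE (𝕜 := ℝ) (E := F)).continuous.comp_stronglyMeasurable
        ((hfm.mono le_sup_right).indicator hs')
    have heq : (fun ω => ContinuousLinearMap.toSpanSingleton ℝ
        (s.indicator (fun ω => f (X (t + 1) ω)) ω) (W (t + 1) ω - 1))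
        = s.indicator fun ω => (W (t + 1) ω - 1) • f (X (t + 1) ω) := by
      ext ω
      by_cases hω : ω ∈ s <;> simp [hω, ContinuousLinearMap.toSpanSingleton_apply]
    have := integral_clm_apply_eq_zero hle' hDi hweights hψ (by
      rw [heq]; exact hi1.indicator (hle _ hs))
    rwa [heq, integral_indicator (hle _ hs)] at this
  · intro t ht ω
    have h1 : f (X (t + 1) ω) - c = g (X (t + 1) ω) - h (X (t + 1) ω) := hfg (X (t + 1) ω)
    have h2 : c + ((W (t + 1) ω - 1) • f (X (t + 1) ω) + (g (X (t + 1) ω) - h (X t ω)))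
        + (h (X t ω) - h (X (t + 1) ω)) = W (t + 1) ω • f (X (t + 1) ω)
          + ((g (X (t + 1) ω) - h (X (t + 1) ω)) - (f (X (t + 1) ω) - c)) := by
      rw [sub_smul, one_smul]; abel
    change _ = c + ((W (t + 1) ω - 1) • f (X (t + 1) ω) + (g (X (t + 1) ω) - h (X t ω)))
        + (h (X t ω) - h (X (t + 1) ω))
    rw [h2, h1, sub_self, add_zero]

end Weights

/-! ### Quadratic Lyapunov functions for Hurwitz matrices -/

section Lyapunov

/-- `S` is a Lyapunov operator for `T`: `u ↦ ⟪S u, u⟫` is a quadratic form dominating `‖u‖²`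
which decreases along `T` at rate `c`. -/
structure IsLyapunov {E : Type*} [NormedAddCommGroup E] [InnerProductSpace ℝ E]
    (T S : E →L[ℝ] E) (c : ℝ) : Prop where
  symm : ∀ u v, inner ℝ (S u) v = inner ℝ (S v) u
  coercive : ∀ u, ‖u‖ ^ 2 ≤ inner ℝ (S u) u
  pos : 0 < c
  decrease : ∀ u, inner ℝ (S u) (T u) ≤ -c * ‖u‖ ^ 2

/-- With `B = 1 + hT`, take `S = ∑_{k<N} (Bᵏ)* Bᵏ`. The form telescopes along `B`, changing by
`‖Bᴺu‖² - ‖u‖² ≤ -(3/4)‖u‖²`. Expanding `B` and dropping the nonnegative term in `h²` leaves `2h⟪Su,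
Tu⟫`, whence the rate `3/(8h)`. -/
lemma exists_isLyapunov_of_norm_pow_le {E : Type*} [NormedAddCommGroup E] [InnerProductSpace ℝ E]
    [CompleteSpace E] (T : E →L[ℝ] E) {h : ℝ} (hh : 0 < h) {N : ℕ} (hN : N ≠ 0)
    (hT : ‖(1 + h • T) ^ N‖ ≤ 1 / 2) : ∃ S c, IsLyapunov T S c := by
  set B : E →L[ℝ] E := 1 + h • T with hB
  set S : E →L[ℝ] E := ∑ k ∈ Finset.range N, (B ^ k).adjoint ∘L (B ^ k) with hS
  have hSin : ∀ u v, inner ℝ (S u) v = ∑ k ∈ Finset.range N, inner ℝ ((B ^ k) u) ((B ^ k) v) := by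
    intro u v
    simp [hS, sum_inner, ContinuousLinearMap.adjoint_inner_left]
  have hSsq : ∀ u, inner ℝ (S u) u = ∑ k ∈ Finset.range N, ‖(B ^ k) u‖ ^ 2 := by
    intro u
    simp [hSin]
  have hsymm : ∀ u v, inner ℝ (S u) v = inner ℝ (S v) u := fun u v => by
    rw [hSin, hSin]
    exact Finset.sum_congr rfl fun k _ => real_inner_comm _ _
  have hnonneg : ∀ u, 0 ≤ inner ℝ (S u) u := fun u => by
    rw [hSsq]; positivity
  refine ⟨S, 3 / (8 * h), hsymm, fun u => ?_, by positivity, fun u => ?_⟩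
  · rw [hSsq]
    have h0 : (0 : ℕ) ∈ Finset.range N := by simp; omega
    have := Finset.single_le_sum (f := fun k => ‖(B ^ k) u‖ ^ 2) (fun _ _ => by positivity) h0
    simpa using this
  · have h1 : inner ℝ (S (B u)) (B u) = inner ℝ (S u) u + ‖(B ^ N) u‖ ^ 2 - ‖u‖ ^ 2 := by
      rw [hSsq, hSsq]
      have e : ∀ k, (B ^ k) (B u) = (B ^ (k + 1)) u := fun k => by rw [pow_succ]; rfl
      simp_rw [e]
      have h2 := Finset.sum_range_succ (fun k => ‖(B ^ k) u‖ ^ 2) N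
      have h3 := Finset.sum_range_succ' (fun k => ‖(B ^ k) u‖ ^ 2) N
      simp only [pow_zero, one_apply_eq_self] at h3
      linarith
    have h2 : inner ℝ (S (B u)) (B u) = inner ℝ (S u) u + 2 * h * inner ℝ (S u) (T u)
        + h ^ 2 * inner ℝ (S (T u)) (T u) := by
      have e : B u = u + h • T u := by simp [hB]
      rw [e, map_add, map_smul]
      simp only [inner_add_left, inner_add_right, inner_smul_left, inner_smul_right,
        RCLike.conj_to_real]
      rw [hsymm (T u) u]
      ring
    have h3 : ‖(B ^ N) u‖ ≤ 1 / 2 * ‖u‖ :=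
      ((B ^ N).le_opNorm u).trans (by gcongr)
    have h4 : ‖(B ^ N) u‖ ^ 2 ≤ 1 / 4 * ‖u‖ ^ 2 := by
      calc _ ≤ (1 / 2 * ‖u‖) ^ 2 := by gcongr
        _ = _ := by ring
    have h5 := mul_nonneg (sq_nonneg h) (hnonneg (T u))
    have h6 : 2 * h * inner ℝ (S u) (T u) ≤ - (3 / 4) * ‖u‖ ^ 2 := by linarith
    have h7 : -(3 / (8 * h)) * ‖u‖ ^ 2 = (- (3 / 4) * ‖u‖ ^ 2) / (2 * h) := by
      field_simp; ring
    rw [h7, le_div_iff₀ (by positivity)]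
    linarith

/-- By Gelfand's formula the powers are eventually dominated by those of some `r < 1`. -/
lemma tendsto_norm_pow_of_spectralRadius_lt_one {R : Type*} [NormedRing R] [NormedAlgebra ℂ R]
    [CompleteSpace R] {a : R} (ha : spectralRadius ℂ a < 1) :
    Tendsto (fun n : ℕ => a ^ n) atTop (𝓝 0) := by
  obtain ⟨r, h1, h2⟩ := ENNReal.lt_iff_exists_nnreal_btwn.1 ha
  have hr1 : r < 1 := by exact_mod_cast h2
  have hev := (spectrum.pow_nnnorm_pow_one_div_tendsto_nhds_spectralRadius a).eventually_lt_const h1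
  refine squeeze_zero_norm' (a := fun n : ℕ => (r : ℝ) ^ n) ?_
    (tendsto_pow_atTop_nhds_zero_of_lt_one r.2 (by exact_mod_cast hr1))
  filter_upwards [hev, eventually_ge_atTop 1] with n hn hn1
  have hn0 : (n : ℝ) ≠ 0 := by positivity
  have h3 : (‖a ^ n‖₊ : ENNReal) ≤ (r : ENNReal) ^ (n : ℝ) := by
    have := ENNReal.rpow_le_rpow hn.le (z := (n : ℝ)) (by positivity)
    rwa [← ENNReal.rpow_mul, one_div_mul_cancel hn0, ENNReal.rpow_one] at this
  rw [ENNReal.rpow_natCast] at h3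
  exact_mod_cast h3

/-- `|1 + hz|² = 1 + h(2 Re z + h|z|²)` is below 1 for small `h > 0`, and finitely many eigenvalues
allow a common `h`. -/
lemma exists_step_of_isHurwitz {d : ℕ} {A : Matrix (Fin d) (Fin d) ℝ} (hA : IsHurwitz A) :
    ∃ h : ℝ, 0 < h ∧ ∀ z : ℂ, Module.End.HasEigenvalue
      (Matrix.toLin' (A.map (algebraMap ℝ ℂ))) z → ‖1 + h * z‖ < 1 := by
  have hfin : {z : ℂ | Module.End.HasEigenvalue
      (Matrix.toLin' (A.map (algebraMap ℝ ℂ))) z}.Finite :=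
    Module.End.finite_hasEigenvalue _
  have hev : ∀ᶠ h : ℝ in 𝓝[>] 0, ∀ z ∈ {z : ℂ | Module.End.HasEigenvalue
      (Matrix.toLin' (A.map (algebraMap ℝ ℂ))) z}, ‖1 + h * z‖ < 1 := by
    rw [eventually_all_finite hfin]
    intro z hz
    have hz' : z.re < 0 := hA z hz
    have hlim : Tendsto (fun h : ℝ => 2 * z.re + h * ‖z‖ ^ 2) (𝓝[>] 0) (𝓝 (2 * z.re)) := by
      have : Continuous fun h : ℝ => 2 * z.re + h * ‖z‖ ^ 2 := by fun_prop
      simpa using (this.tendsto 0).mono_left nhdsWithin_le_nhds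
    filter_upwards [hlim.eventually_lt_const (show 2 * z.re < 0 by linarith),
      self_mem_nhdsWithin] with h hh hpos
    have hpos' : 0 < h := hpos
    have h1 : ‖1 + (h : ℂ) * z‖ ^ 2 = 1 + h * (2 * z.re + h * ‖z‖ ^ 2) := by
      rw [← Complex.normSq_eq_norm_sq, ← Complex.normSq_eq_norm_sq]
      simp [Complex.normSq_apply]
      ring
    have h2 : ‖1 + (h : ℂ) * z‖ ^ 2 < 1 := by
      rw [h1]; nlinarith
    exact lt_of_pow_lt_pow_left₀ 2 zero_le_one (by simpa using h2)
  obtain ⟨h, h1, h2⟩ := (hev.and self_mem_nhdsWithin).exists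
  exact ⟨h, h2, h1⟩

lemma spectralRadius_lt_one_of_step {d : ℕ} [NeZero d] {A : Matrix (Fin d) (Fin d) ℝ} {h : ℝ}
    (hh : 0 < h) (hA : ∀ z : ℂ, Module.End.HasEigenvalue
      (Matrix.toLin' (A.map (algebraMap ℝ ℂ))) z → ‖1 + h * z‖ < 1) :
    spectralRadius ℂ ((1 + h • A).map (algebraMap ℝ ℂ)) < 1 := by
  have := spectrum.spectralRadius_lt_of_forall_lt ((1 + h • A).map (algebraMap ℝ ℂ)) (r := 1) ?_
  · simpa using this
  intro z hz
  have hz' : Module.End.HasEigenvalue (Matrix.toLin' ((1 + h • A).map (algebraMap ℝ ℂ))) z := by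
    rw [Module.End.hasEigenvalue_iff_mem_spectrum]
    rwa [← AlgEquiv.spectrum_eq Matrix.toLinAlgEquiv'] at hz
  obtain ⟨v, hv⟩ := hz'.exists_hasEigenvector
  have hmap : (1 + h • A).map (algebraMap ℝ ℂ) = 1 + (h : ℂ) • A.map (algebraMap ℝ ℂ) := by
    ext i j
    by_cases hij : i = j <;> simp [hij]
  have hh' : (h : ℂ) ≠ 0 := by exact_mod_cast hh.ne'
  have hev : Module.End.HasEigenvalue (Matrix.toLin' (A.map (algebraMap ℝ ℂ)))
      ((z - 1) / h) := by
    refine Module.End.hasEigenvalue_of_hasEigenvector (x := v) ⟨?_, hv.2⟩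
    rw [Module.End.mem_eigenspace_iff]
    have h1 := hv.apply_eq_smul
    rw [hmap, map_add, map_smul, Matrix.toLin'_one] at h1
    simp only [LinearMap.add_apply, LinearMap.id_apply, LinearMap.smul_apply] at h1
    rw [div_eq_inv_mul, mul_smul, sub_smul, one_smul, ← h1, add_sub_cancel_left,
      inv_smul_smul₀ hh']
  have := hA _ hev
  rw [mul_div_cancel₀ _ hh', add_sub_cancel] at this
  exact_mod_cast this

theorem exists_isLyapunov_of_isHurwitz {d : ℕ} {A : Matrix (Fin d) (Fin d) ℝ}
    (hA : IsHurwitz A) : ∃ S c, IsLyapunov (Matrix.toEuclideanCLM (𝕜 := ℝ) A) S c := by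
  rcases Nat.eq_zero_or_pos d with rfl | hd
  · exact ⟨0, 1, by simp, fun u => by simp [Subsingleton.elim u 0], one_pos,
      fun u => by simp [Subsingleton.elim u 0]⟩
  have : NeZero d := ⟨hd.ne'⟩
  obtain ⟨h, hh, hstep⟩ := exists_step_of_isHurwitz hA
  have hlim := tendsto_norm_pow_of_spectralRadius_lt_one (spectralRadius_lt_one_of_step hh hstep)
  have hpow : ∀ n : ℕ, ((1 + h • A).map (algebraMap ℝ ℂ)) ^ n
      = ((1 + h • A) ^ n).map (algebraMap ℝ ℂ) := fun n =>
    (map_pow (RingHom.mapMatrix (algebraMap ℝ ℂ)) (1 + h • A) n).symm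
  simp_rw [hpow] at hlim
  have hreal : Tendsto (fun n : ℕ => (1 + h • A) ^ n) atTop (𝓝 0) := by
    refine tendsto_zero_iff_norm_tendsto_zero.2
      ((tendsto_zero_iff_norm_tendsto_zero.1 hlim).congr fun n => ?_)
    -- Complexification preserves the Frobenius norm, so the decay of the complex powers descends to
    -- the real ones.
    exact Matrix.frobenius_norm_map_eq _ _ fun x => by simp
  have hcont : Continuous (Matrix.toEuclideanCLM (n := Fin d) (𝕜 := ℝ)) :=
    LinearMap.continuous_of_finiteDimensional
      (Matrix.toEuclideanCLM (n := Fin d) (𝕜 := ℝ)).toAlgEquiv.toLinearMap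
  have hclm : Tendsto (fun n : ℕ => ‖Matrix.toEuclideanCLM (n := Fin d) (𝕜 := ℝ)
      ((1 + h • A) ^ n)‖) atTop (𝓝 0) := by
    have := ((hcont.tendsto 0).comp hreal).norm
    simpa using this
  obtain ⟨N, h1, h2⟩ := ((hclm.eventually_le_const (show (0 : ℝ) < 1 / 2 by norm_num)).and
    (eventually_ne_atTop 0)).exists
  refine exists_isLyapunov_of_norm_pow_le _ hh h2 ?_
  rwa [map_pow, map_add, map_one, map_smul] at h1

end Lyapunov

/-! ### Step sizes: asymptotics, a scalar recursion, Abel summation -/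

section StepSizes

/-- Slowly decreasing step sizes, as needed for Polyak–Ruppert averaging. -/
structure IsSlowlyDecreasing (α : ℕ → ℝ) : Prop where
  pos : ∀ t, 1 ≤ t → 0 < α t
  anti : ∀ t, 1 ≤ t → α (t + 1) ≤ α t
  le_two_mul : ∀ t, 1 ≤ t → α t ≤ 2 * α (t + 1)
  tendsto_zero : Tendsto α atTop (𝓝 0)
  tendsto_inv_sub : Tendsto (fun t => (α (t + 1))⁻¹ - (α t)⁻¹) atTop (𝓝 0)
  tendsto_sum : Tendsto (fun t : ℕ => (√t)⁻¹ * ∑ i ∈ Finset.Icc 1 t, α i) atTop (𝓝 0)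
  tendsto_inv_sqrt : Tendsto (fun t : ℕ => (√t)⁻¹ * (√(α (t + 1)))⁻¹) atTop (𝓝 0)

/-- Compare with the increments `√(i+1) - √i ≥ 1/(2√(i+1))`, which sum to `√t`: a sequence
negligible against them has partial sums `o(√t)`. -/
lemma tendsto_inv_sqrt_mul_sum {a : ℕ → ℝ}
    (ha : a =o[atTop] fun i : ℕ => (√(i : ℝ))⁻¹) :
    Tendsto (fun t : ℕ => (√t)⁻¹ * ∑ i ∈ Finset.Icc 1 t, a i) atTop (𝓝 0) := by
  set g : ℕ → ℝ := fun i => √((i + 1 : ℕ) : ℝ) - √(i : ℝ) with hg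
  have hgsum : ∀ t, ∑ i ∈ Finset.range t, g i = √(t : ℝ) := fun t =>
    (Finset.sum_range_sub (fun i : ℕ => √(i : ℝ)) t).trans (by simp)
  have hbig : (fun i : ℕ => (√((i + 1 : ℕ) : ℝ))⁻¹) =O[atTop] g := by
    refine Asymptotics.IsBigO.of_bound 2 (Eventually.of_forall fun i => ?_)
    have h1 : 0 < √((i + 1 : ℕ) : ℝ) := Real.sqrt_pos.2 (by positivity)
    have h2 : √(i : ℝ) ≤ √((i + 1 : ℕ) : ℝ) := Real.sqrt_le_sqrt (by push_cast; linarith)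
    have h3 : √((i + 1 : ℕ) : ℝ) ^ 2 = i + 1 := by
      rw [Real.sq_sqrt (by positivity)]; push_cast; ring
    have h4 : √(i : ℝ) ^ 2 = i := Real.sq_sqrt (by positivity)
    rw [Real.norm_of_nonneg (by positivity), Real.norm_of_nonneg (by simp only [hg]; linarith),
      inv_le_iff_one_le_mul₀ h1]
    simp only [hg]
    nlinarith [Real.sqrt_nonneg (i : ℝ)]
  have hshift : (fun i => a (i + 1)) =o[atTop] g :=
    (ha.comp_tendsto (tendsto_add_atTop_nat 1)).trans_isBigO hbig
  have hsum := hshift.sum_range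
    (fun i => sub_nonneg.2 (Real.sqrt_le_sqrt (by push_cast; linarith))) (by
      simp_rw [hgsum]
      exact Real.tendsto_sqrt_atTop.comp tendsto_natCast_atTop_atTop)
  simp_rw [hgsum] at hsum
  refine hsum.tendsto_div_nhds_zero.congr fun t => ?_
  rw [div_eq_inv_mul, Finset.range_eq_Ico, Finset.sum_Ico_add' a 0 t 1]
  rfl

/-- `η > 1/2` is what makes `∑ α_i = o(√t)`; `η < 1` gives vanishing increments of `1/α` and
`α_{t+1}^{-1/2} = o(√t)`. -/
lemma isSlowlyDecreasing_stepSize {α₀ η : ℝ} (hα₀ : 0 < α₀) (hη : η ∈ Set.Ioo (1 / 2 : ℝ) 1) :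
    IsSlowlyDecreasing (stepSize α₀ η) := by
  obtain ⟨h1, h2⟩ := hη
  have h0 : 0 < η := by linarith
  have hpos : ∀ t, 1 ≤ t → 0 < stepSize α₀ η t := fun t ht => by
    have : (0 : ℝ) < t := by exact_mod_cast ht
    unfold stepSize; positivity
  refine ⟨hpos, fun t ht => ?_, fun t ht => ?_, ?_, ?_, ?_, ?_⟩
  · have : (0 : ℝ) < t := by exact_mod_cast ht
    unfold stepSize
    gcongr
    simp
  · have h3 : (1 : ℝ) ≤ t := by exact_mod_cast ht
    unfold stepSize
    rw [div_le_iff₀ (by positivity)]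
    have h4 : ((t + 1 : ℕ) : ℝ) ^ η ≤ 2 * (t : ℝ) ^ η := by
      calc ((t + 1 : ℕ) : ℝ) ^ η ≤ (2 * t : ℝ) ^ η := by
            gcongr; push_cast; linarith
        _ = 2 ^ η * (t : ℝ) ^ η := Real.mul_rpow (by norm_num) (by linarith)
        _ ≤ 2 ^ (1 : ℝ) * (t : ℝ) ^ η := by
            gcongr; norm_num
        _ = _ := by norm_num
    have h5 : (0 : ℝ) < ((t + 1 : ℕ) : ℝ) ^ η := by positivity
    rw [show 2 * (α₀ / ((t + 1 : ℕ) : ℝ) ^ η) * (t : ℝ) ^ η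
      = α₀ * ((2 * (t : ℝ) ^ η) / ((t + 1 : ℕ) : ℝ) ^ η) by ring]
    exact le_mul_of_one_le_right hα₀.le ((one_le_div h5).2 h4)
  · exact tendsto_const_nhds.div_atTop
      ((tendsto_rpow_atTop h0).comp tendsto_natCast_atTop_atTop)
  · have hlim : Tendsto (fun t : ℕ => α₀⁻¹ * (η * (t : ℝ) ^ (-(1 - η)))) atTop (𝓝 0) := by
      have := ((tendsto_rpow_neg_atTop (show 0 < 1 - η by linarith)).comp
        tendsto_natCast_atTop_atTop).const_mul η |>.const_mul α₀⁻¹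
      simpa using this
    refine squeeze_zero' ?_ ?_ hlim
    · filter_upwards [eventually_ge_atTop 1] with t ht
      have : (0 : ℝ) < t := by exact_mod_cast ht
      unfold stepSize
      rw [sub_nonneg]
      gcongr
      simp
    · filter_upwards [eventually_ge_atTop 1] with t ht
      have h3 : (0 : ℝ) < t := by exact_mod_cast ht
      unfold stepSize
      have h4 : ((t + 1 : ℕ) : ℝ) ^ η = (t : ℝ) ^ η * (1 + (t : ℝ)⁻¹) ^ η := by
        rw [← Real.mul_rpow h3.le (by positivity)]
        congr 1; push_cast; field_simp
      -- Bernoulli's inequality for exponents at most 1 bounds the increments of `t^η` by `η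
      -- t^{η-1}`.
      have h5 : (1 + (t : ℝ)⁻¹) ^ η ≤ 1 + η * (t : ℝ)⁻¹ :=
        rpow_one_add_le_one_add_mul_self (by linarith [inv_pos.2 h3]) h0.le h2.le
      have h6 : (t : ℝ) ^ (-(1 - η)) = (t : ℝ) ^ η * (t : ℝ)⁻¹ := by
        rw [← Real.rpow_neg_one, ← Real.rpow_add h3]; congr 1; ring
      have h7 : 0 < (t : ℝ) ^ η := by positivity
      rw [inv_div, inv_div, h4, h6, div_sub_div_same, div_eq_inv_mul]
      gcongr
      nlinarith
  · apply tendsto_inv_sqrt_mul_sum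
    rw [Asymptotics.isLittleO_iff_tendsto']
    · have hlim : Tendsto (fun t : ℕ => α₀ * (t : ℝ) ^ (-(η - 1 / 2))) atTop (𝓝 0) := by
        have := ((tendsto_rpow_neg_atTop (show 0 < η - 1 / 2 by linarith)).comp
          tendsto_natCast_atTop_atTop).const_mul α₀
        simpa using this
      refine hlim.congr' ?_
      filter_upwards [eventually_ge_atTop 1] with t ht
      have h3 : (0 : ℝ) < t := by exact_mod_cast ht
      unfold stepSize
      rw [div_inv_eq_mul, Real.sqrt_eq_rpow, div_mul_eq_mul_div, mul_div_assoc,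
        ← Real.rpow_sub h3]
      congr 2; ring
    · filter_upwards [eventually_ge_atTop 1] with t ht h
      have h3 : (0 : ℝ) < t := by exact_mod_cast ht
      have := inv_pos.2 (Real.sqrt_pos.2 h3)
      linarith
  · have hlim : Tendsto (fun t : ℕ => 2 * ((√α₀)⁻¹ * (t : ℝ) ^ (-((1 - η) / 2)))) atTop (𝓝 0) := by
      have := ((tendsto_rpow_neg_atTop (show 0 < (1 - η) / 2 by linarith)).comp
        tendsto_natCast_atTop_atTop).const_mul (√α₀)⁻¹ |>.const_mul 2
      simpa using this
    refine squeeze_zero' (Eventually.of_forall fun t => by positivity) ?_ hlim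
    filter_upwards [eventually_ge_atTop 1] with t ht
    have h3 : (1 : ℝ) ≤ t := by exact_mod_cast ht
    have h3' : (0 : ℝ) < t := by linarith
    have h4 : (√(stepSize α₀ η (t + 1)))⁻¹ = (√α₀)⁻¹ * ((t + 1 : ℕ) : ℝ) ^ (η / 2) := by
      unfold stepSize
      rw [Real.sqrt_div hα₀.le, inv_div, div_eq_inv_mul, Real.sqrt_eq_rpow (_ ^ η),
        ← Real.rpow_mul (by positivity)]
      congr 2; ring
    have h5 : ((t + 1 : ℕ) : ℝ) ^ (η / 2) ≤ 2 * (t : ℝ) ^ (η / 2) := by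
      calc ((t + 1 : ℕ) : ℝ) ^ (η / 2) ≤ (2 * t : ℝ) ^ (η / 2) := by
            gcongr; push_cast; linarith
        _ = 2 ^ (η / 2) * (t : ℝ) ^ (η / 2) := Real.mul_rpow (by norm_num) (by linarith)
        _ ≤ 2 ^ (1 : ℝ) * (t : ℝ) ^ (η / 2) := by
            gcongr
            · norm_num
            · linarith
        _ = _ := by norm_num
    have h6 : (√(t : ℝ))⁻¹ * (t : ℝ) ^ (η / 2) = (t : ℝ) ^ (-((1 - η) / 2)) := by
      rw [Real.sqrt_eq_rpow, ← Real.rpow_neg h3'.le, ← Real.rpow_add h3']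
      congr 1; ring
    rw [h4, ← h6]
    calc (√(t : ℝ))⁻¹ * ((√α₀)⁻¹ * ((t + 1 : ℕ) : ℝ) ^ (η / 2))
        ≤ (√(t : ℝ))⁻¹ * ((√α₀)⁻¹ * (2 * (t : ℝ) ^ (η / 2))) := by gcongr
      _ = _ := by ring

variable {α : ℕ → ℝ}

/-- Induction on `v t ≤ K α t`. The contraction gains `c K α_t α_{t+1}`: one half pays for the drop
`K (α_t - α_{t+1})`, small because the increments of `1/α` vanish, the other for `C α_{t+1}²`. -/
lemma IsSlowlyDecreasing.le_mul_of_recursion (hα : IsSlowlyDecreasing α) {v : ℕ → ℝ} {c C : ℝ}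
    (hc : 0 < c) (hC : 0 ≤ C)
    (hv : ∀ᶠ t in atTop, v (t + 1) ≤ (1 - c * α (t + 1)) * v t + C * α (t + 1) ^ 2) :
    ∃ K, 0 ≤ K ∧ ∀ t, 1 ≤ t → v t ≤ K * α t := by
  have hlim1 := (hα.tendsto_zero.comp (tendsto_add_atTop_nat 1)).eventually_le_const
    (show 0 < c⁻¹ by positivity)
  have hlim2 := hα.tendsto_inv_sub.eventually_le_const (show 0 < c / 2 by positivity)
  obtain ⟨T, hT⟩ := eventually_atTop.1 ((hlim1.and hlim2).and (hv.and (eventually_ge_atTop 1)))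
  have hT1 : 1 ≤ T := (hT T le_rfl).2.2
  -- The sum covers the times up to `T`; the term `2 * C / c` gives `C ≤ K * c / 2`, as the
  -- induction requires.
  set K := ∑ i ∈ Finset.Icc 1 T, |v i| / α i + 2 * C / c with hK
  have hsum : ∀ i ∈ Finset.Icc 1 T, 0 ≤ |v i| / α i := fun i hi =>
    div_nonneg (abs_nonneg _) (hα.pos i (Finset.mem_Icc.1 hi).1).le
  have hK0 : 2 * C / c ≤ K := le_add_of_nonneg_left (Finset.sum_nonneg hsum)
  have hKnn : 0 ≤ K := le_trans (by positivity) hK0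
  have hCK : C ≤ K * c / 2 := by
    rw [div_le_iff₀ hc] at hK0; linarith
  have hsmall : ∀ t, 1 ≤ t → t ≤ T → v t ≤ K * α t := fun t h1 h2 => by
    have h3 : |v t| / α t ≤ K := (Finset.single_le_sum hsum (Finset.mem_Icc.2 ⟨h1, h2⟩)).trans
      (le_add_of_nonneg_right (by positivity))
    exact (le_abs_self _).trans ((div_le_iff₀ (hα.pos t h1)).1 h3)
  have hlarge : ∀ t, T ≤ t → v t ≤ K * α t := by
    intro t ht
    induction t, ht using Nat.le_induction with
    | base => exact hsmall T hT1 le_rfl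
    | succ t ht ih =>
      obtain ⟨⟨h1, h2⟩, h3, h4⟩ := hT t ht
      have ha := hα.pos t h4
      have hb := hα.pos (t + 1) (by omega)
      have hba := hα.anti t h4
      simp only [Function.comp_apply] at h1
      have h5 : 0 ≤ 1 - c * α (t + 1) := by
        have := mul_le_mul_of_nonneg_left h1 hc.le
        rw [mul_inv_cancel₀ hc.ne'] at this
        linarith
      have h6 : α t - α (t + 1) ≤ c / 2 * (α t * α (t + 1)) := by
        have := mul_le_mul_of_nonneg_right h2 (mul_pos ha hb).le
        rw [show ((α (t + 1))⁻¹ - (α t)⁻¹) * (α t * α (t + 1)) = α t - α (t + 1) by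
          field_simp] at this
        exact this
      have h7 := mul_le_mul_of_nonneg_left ih h5
      have h8 := mul_le_mul_of_nonneg_left h6 hKnn
      have h9 : C * α (t + 1) ^ 2 ≤ K * c / 2 * (α t * α (t + 1)) := by
        gcongr
        nlinarith
      nlinarith
  refine ⟨K, hKnn, fun t ht => ?_⟩
  rcases le_total t T with h | h
  · exact hsmall t ht h
  · exact hlarge t h

/-- With `s = α^{-1/2}` and `s_i n_i ≤ K`, the increment `(s_{i+1}² - s_i²) n_i` is at most `3K
(s_{i+1} - s_i)`, because `s_{i+1} ≤ 2 s_i`, and this telescopes. Applied to norms, it bounds the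
Abel-summed corrected errors. -/
lemma IsSlowlyDecreasing.summation_by_parts_bound (hα : IsSlowlyDecreasing α) {n : ℕ → ℝ} {K : ℝ}
    (hK : 0 ≤ K) (hn : ∀ t, 1 ≤ t → n t ≤ K * √(α t)) (t : ℕ) :
    (α (t + 1))⁻¹ * n (t + 1) + (α 1)⁻¹ * n 1
      + ∑ i ∈ Finset.Icc 1 t, ((α (i + 1))⁻¹ - (α i)⁻¹) * n i ≤ 5 * K * (√(α (t + 1)))⁻¹ := by
  set s : ℕ → ℝ := fun i => (√(α i))⁻¹ with hs
  have hsp : ∀ i, 1 ≤ i → 0 < s i := fun i hi => inv_pos.2 (Real.sqrt_pos.2 (hα.pos i hi))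
  have hsq : ∀ i, 1 ≤ i → (α i)⁻¹ = s i ^ 2 := fun i hi => by
    rw [hs, inv_pow, Real.sq_sqrt (hα.pos i hi).le]
  have hns : ∀ i, 1 ≤ i → s i * n i ≤ K := fun i hi => by
    have := mul_le_mul_of_nonneg_left (hn i hi) (hsp i hi).le
    rwa [show s i * (K * √(α i)) = K * (s i * √(α i)) by ring, hs,
      inv_mul_cancel₀ (Real.sqrt_pos.2 (hα.pos i hi)).ne', mul_one] at this
  have hmono : ∀ i, 1 ≤ i → s i ≤ s (i + 1) := fun i hi =>
    inv_anti₀ (Real.sqrt_pos.2 (hα.pos _ (by omega))) (Real.sqrt_le_sqrt (hα.anti i hi))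
  have hdouble : ∀ i, 1 ≤ i → s (i + 1) ≤ 2 * s i := fun i hi => by
    have h1 : (α (i + 1))⁻¹ ≤ 2 * (α i)⁻¹ := by
      rw [inv_le_iff_one_le_mul₀ (hα.pos _ (by omega)), mul_right_comm, ← div_eq_mul_inv,
        one_le_div (hα.pos i hi)]
      exact hα.le_two_mul i hi
    rw [hsq i hi, hsq (i + 1) (by omega)] at h1
    have := hsp i hi
    nlinarith
  have hterm : ∀ i, 1 ≤ i → (α i)⁻¹ * n i ≤ K * s i := fun i hi => by
    rw [hsq i hi]
    nlinarith [mul_le_mul_of_nonneg_left (hns i hi) (hsp i hi).le]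
  have hsum : ∀ t, (α 1)⁻¹ * n 1 + ∑ i ∈ Finset.Icc 1 t, ((α (i + 1))⁻¹ - (α i)⁻¹) * n i
      ≤ K * s 1 + 3 * K * (s (t + 1) - s 1) := by
    intro t
    induction t with
    | zero => simpa using hterm 1 le_rfl
    | succ t ih =>
      rw [Finset.sum_Icc_succ_top (by omega)]
      have h1 : ((α (t + 1 + 1))⁻¹ - (α (t + 1))⁻¹) * n (t + 1)
          ≤ 3 * K * (s (t + 1 + 1) - s (t + 1)) := by
        rw [hsq _ (by omega), hsq _ (by omega)]
        have e1 := hsp (t + 1) (by omega)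
        have e2 := hmono (t + 1) (by omega)
        have e3 := hdouble (t + 1) (by omega)
        have e4 := hns (t + 1) (by omega)
        -- No sign is assumed for `n`; doubling `s` inside the product needs `n` positive.
        by_cases hneg : n (t + 1) ≤ 0
        · have : (s (t + 1 + 1) ^ 2 - s (t + 1) ^ 2) * n (t + 1) ≤ 0 :=
            mul_nonpos_of_nonneg_of_nonpos (by nlinarith) hneg
          have : 0 ≤ 3 * K * (s (t + 1 + 1) - s (t + 1)) := by
            have := sub_nonneg.2 e2
            positivity
          linarith
        · push Not at hneg
          calc (s (t + 1 + 1) ^ 2 - s (t + 1) ^ 2) * n (t + 1)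
              = (s (t + 1 + 1) - s (t + 1)) * ((s (t + 1 + 1) + s (t + 1)) * n (t + 1)) := by ring
            _ ≤ (s (t + 1 + 1) - s (t + 1)) * (3 * (s (t + 1) * n (t + 1))) := by
                refine mul_le_mul_of_nonneg_left ?_ (sub_nonneg.2 e2)
                nlinarith
            _ ≤ (s (t + 1 + 1) - s (t + 1)) * (3 * K) := by
                refine mul_le_mul_of_nonneg_left ?_ (sub_nonneg.2 e2)
                linarith
            _ = _ := by ring
      linarith
  have h1 := hterm (t + 1) (by omega)
  have h2 := hsum t
  have h3 := mul_nonneg hK (hsp 1 le_rfl).le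
  change _ ≤ 5 * K * s (t + 1)
  have h4 := mul_nonneg hK (hsp (t + 1) (by omega)).le
  nlinarith

lemma summation_by_parts {F : Type*} [AddCommGroup F] [Module ℝ F] (β : ℕ → ℝ) (x : ℕ → F)
    (t : ℕ) : ∑ i ∈ Finset.Icc 1 t, β (i + 1) • (x (i + 1) - x i)
      = β (t + 1) • x (t + 1) - β 1 • x 1 - ∑ i ∈ Finset.Icc 1 t, (β (i + 1) - β i) • x i := by
  induction t with
  | zero => simp
  | succ t ih =>
    rw [Finset.sum_Icc_succ_top (by omega), Finset.sum_Icc_succ_top (by omega), ih]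
    simp only [smul_sub, sub_smul]
    abel

end StepSizes

/-! ### Calculus of essentially bounded adapted functions -/

section BoundedMeasurable

variable {Ω F G : Type*} {mΩ : MeasurableSpace Ω} {P : Measure Ω}
  [NormedAddCommGroup F] [NormedAddCommGroup G]
  {m m' : MeasurableSpace Ω} {f g : Ω → F}

/-- Essentially bounded, strongly `m`-measurable functions. -/
def IsBddMeas (P : Measure Ω) (m : MeasurableSpace Ω) (f : Ω → F) : Prop :=
  StronglyMeasurable[m] f ∧ ∃ B, ∀ᵐ ω ∂P, ‖f ω‖ ≤ B

namespace IsBddMeas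

lemma mono (hf : IsBddMeas P m f) (h : m ≤ m') : IsBddMeas P m' f :=
  ⟨hf.1.mono h, hf.2⟩

lemma add (hf : IsBddMeas P m f) (hg : IsBddMeas P m g) :
    IsBddMeas P m (fun ω => f ω + g ω) := by
  obtain ⟨hf, A, hA⟩ := hf
  obtain ⟨hg, B, hB⟩ := hg
  refine ⟨hf.add hg, A + B, ?_⟩
  filter_upwards [hA, hB] with ω h1 h2
  exact (norm_add_le _ _).trans (add_le_add h1 h2)

lemma sub (hf : IsBddMeas P m f) (hg : IsBddMeas P m g) :
    IsBddMeas P m (fun ω => f ω - g ω) := by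
  obtain ⟨hf, A, hA⟩ := hf
  obtain ⟨hg, B, hB⟩ := hg
  refine ⟨hf.sub hg, A + B, ?_⟩
  filter_upwards [hA, hB] with ω h1 h2
  exact (norm_sub_le _ _).trans (add_le_add h1 h2)

lemma const_smul [NormedSpace ℝ F] (hf : IsBddMeas P m f) (c : ℝ) : IsBddMeas P m (fun ω => c • f ω) := by
  obtain ⟨hf, A, hA⟩ := hf
  refine ⟨hf.const_smul c, ‖c‖ * A, ?_⟩
  filter_upwards [hA] with ω h1
  rw [norm_smul]
  gcongr

lemma clm_apply [NormedSpace ℝ F] [NormedSpace ℝ G] {L : Ω → F →L[ℝ] G} (hL : IsBddMeas P m L) (hf : IsBddMeas P m f) :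
    IsBddMeas P m (fun ω => L ω (f ω)) := by
  obtain ⟨hL, A, hA⟩ := hL
  obtain ⟨hf, B, hB⟩ := hf
  refine ⟨(isBoundedBilinearMap_apply (𝕜 := ℝ) (E := F) (F := G)).continuous.comp_stronglyMeasurable
    (hL.prodMk hf), A * B, ?_⟩
  filter_upwards [hA, hB] with ω h1 h2
  exact (ContinuousLinearMap.le_opNorm _ _).trans
    (mul_le_mul h1 h2 (norm_nonneg _) ((norm_nonneg _).trans h1))

lemma smul [NormedSpace ℝ F] {w : Ω → ℝ} (hw : IsBddMeas P m w) (hf : IsBddMeas P m f) :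
    IsBddMeas P m (fun ω => w ω • f ω) := by
  obtain ⟨hw, A, hA⟩ := hw
  obtain ⟨hf, B, hB⟩ := hf
  refine ⟨hw.smul hf, A * B, ?_⟩
  filter_upwards [hA, hB] with ω h1 h2
  rw [norm_smul]
  exact mul_le_mul h1 h2 (norm_nonneg _) ((norm_nonneg _).trans h1)

lemma const (c : F) : IsBddMeas P m (fun _ => c) :=
  ⟨stronglyMeasurable_const, ‖c‖, ae_of_all _ fun _ => le_rfl⟩

lemma clm_comp [NormedSpace ℝ F] [NormedSpace ℝ G] (L : F →L[ℝ] G) (hf : IsBddMeas P m f) : IsBddMeas P m (fun ω => L (f ω)) :=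
  (const (m := m) L).clm_apply hf

lemma sum {ι : Type*} {s : Finset ι} {f : ι → Ω → F} (hf : ∀ i ∈ s, IsBddMeas P m (f i)) :
    IsBddMeas P m (fun ω => ∑ i ∈ s, f i ω) := by
  classical
  induction s using Finset.induction_on with
  | empty => simpa using const (m := m) (P := P) (0 : F)
  | insert a s ha ih =>
    simp_rw [Finset.sum_insert ha]
    exact (hf a (by simp)).add (ih fun i hi => hf i (by simp [hi]))

lemma norm (hf : IsBddMeas P m f) : IsBddMeas P m (fun ω => ‖f ω‖) :=
  ⟨hf.1.norm, by simpa using hf.2⟩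

lemma norm_sq (hf : IsBddMeas P m f) : IsBddMeas P m (fun ω => ‖f ω‖ ^ 2) := by
  obtain ⟨hf, A, hA⟩ := hf
  refine ⟨hf.norm.pow 2, A ^ 2, ?_⟩
  filter_upwards [hA] with ω h1
  rw [norm_pow, norm_norm]
  gcongr

lemma inner {E : Type*} [NormedAddCommGroup E] [InnerProductSpace ℝ E] {f g : Ω → E}
    (hf : IsBddMeas P m f) (hg : IsBddMeas P m g) :
    IsBddMeas P m (fun ω => inner ℝ (f ω) (g ω)) := by
  obtain ⟨hf, A, hA⟩ := hf
  obtain ⟨hg, B, hB⟩ := hg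
  refine ⟨continuous_inner.comp_stronglyMeasurable (hf.prodMk hg), A * B, ?_⟩
  filter_upwards [hA, hB] with ω h1 h2
  exact (norm_inner_le_norm _ _).trans (mul_le_mul h1 h2 (norm_nonneg _) ((norm_nonneg _).trans h1))

lemma integrable [IsFiniteMeasure P] (hf : IsBddMeas P m f) (hm : m ≤ mΩ) : Integrable f P := by
  obtain ⟨hf, A, hA⟩ := hf
  exact Integrable.of_bound (hf.mono hm).aestronglyMeasurable A hA

end IsBddMeas

end BoundedMeasurable

/-! ### One step of the Lyapunov function -/

section OneStep

variable {E : Type*} [NormedAddCommGroup E] [InnerProductSpace ℝ E]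

/-- Here `x` is the corrected and `e` the true error. Replacing `T e` by `T x` costs `a T(x - e)`,
of order `a²`. The cross term with the noise `N` is kept exactly, because it will integrate to zero.
-/
lemma IsLyapunov.one_step {T S : E →L[ℝ] E} {c : ℝ} (hS : IsLyapunov T S c) {C R : ℝ}
    (hC : 0 ≤ C) (hR : 0 ≤ R) :
    ∃ K, 0 ≤ K ∧ ∀ (a a₀ : ℝ) (x e N r : E), 0 ≤ a → a ≤ 1 → a₀ ≤ 2 * a → a₀ * C ≤ 1 / 2 →
      ‖x - e‖ ≤ a₀ * (C * (1 + ‖e‖)) → ‖N‖ ≤ C * (1 + ‖e‖) → ‖r‖ ≤ R * a ^ 2 * (1 + ‖e‖) →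
      ‖e‖ ≤ 2 * ‖x‖ + 1 ∧
      inner ℝ (S (x + a • (T e + N) + r)) (x + a • (T e + N) + r)
        ≤ inner ℝ (S x) x - 2 * c * a * ‖x‖ ^ 2 + K * a ^ 2 * (1 + ‖x‖ ^ 2)
          + 2 * a * inner ℝ (S x) N := by
  -- The first summand bounds `2⟪S x, w⟫` with `w` the second order error below, the second the
  -- quadratic term in the increment `y`.
  refine ⟨8 * ‖S‖ * (R + 2 * ‖T‖ * C) + 8 * ‖S‖ * (‖T‖ + C + R) ^ 2, by positivity, ?_⟩
  intro a a₀ x e N r ha ha1 haa haC hz hN hr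
  have hs0 := norm_nonneg S
  have ht0 := norm_nonneg T
  have hex : ‖e‖ ≤ 2 * ‖x‖ + 1 := by
    have h1 : ‖e‖ ≤ ‖x‖ + ‖x - e‖ := by
      have := norm_sub_le x (x - e)
      rwa [sub_sub_cancel] at this
    have h2 : a₀ * (C * (1 + ‖e‖)) ≤ 1 / 2 * (1 + ‖e‖) := by
      rw [← mul_assoc]; gcongr
    linarith
  refine ⟨hex, ?_⟩
  set y := a • (T e + N) + r with hy
  set n := 1 + ‖x‖ with hn
  have hn1 : 1 ≤ n := by linarith [norm_nonneg x]
  have he : 1 + ‖e‖ ≤ 2 * n := by linarith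
  have he0 := norm_nonneg e
  set w := r - a • T (x - e) with hw
  have hyw : y = a • T x + a • N + w := by
    simp only [hy, hw, map_sub, smul_add, smul_sub]; abel
  have hwn : ‖w‖ ≤ (R + 2 * ‖T‖ * C) * a ^ 2 * (2 * n) := by
    calc ‖w‖ ≤ ‖r‖ + ‖a • T (x - e)‖ := norm_sub_le _ _
      _ ≤ R * a ^ 2 * (1 + ‖e‖) + a * (‖T‖ * (2 * a * (C * (1 + ‖e‖)))) := by
          rw [norm_smul, Real.norm_of_nonneg ha]
          gcongr
          refine (T.le_opNorm _).trans ?_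
          gcongr
          exact hz.trans (by gcongr)
      _ = (R + 2 * ‖T‖ * C) * a ^ 2 * (1 + ‖e‖) := by ring
      _ ≤ _ := by gcongr
  have hyn : ‖y‖ ≤ (‖T‖ + C + R) * a * (2 * n) := by
    calc ‖y‖ ≤ ‖a • (T e + N)‖ + ‖r‖ := norm_add_le _ _
      _ ≤ a * (‖T‖ * (1 + ‖e‖) + C * (1 + ‖e‖)) + R * a * (1 + ‖e‖) := by
          rw [norm_smul, Real.norm_of_nonneg ha]
          gcongr
          · refine (norm_add_le _ _).trans (add_le_add ((T.le_opNorm _).trans ?_) hN)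
            gcongr
            linarith
          · refine hr.trans ?_
            gcongr
            nlinarith
      _ = (‖T‖ + C + R) * a * (1 + ‖e‖) := by ring
      _ ≤ _ := by gcongr
  have hexp : inner ℝ (S (x + y)) (x + y)
      = inner ℝ (S x) x + 2 * inner ℝ (S x) y + inner ℝ (S y) y := by
    rw [map_add]
    simp only [inner_add_left, inner_add_right]
    rw [hS.symm y x]
    ring
  have hxy : inner ℝ (S x) y = a * inner ℝ (S x) (T x) + a * inner ℝ (S x) N
      + inner ℝ (S x) w := by
    rw [hyw]
    simp only [inner_add_right, inner_smul_right]
  have h1 : a * inner ℝ (S x) (T x) ≤ a * (-c * ‖x‖ ^ 2) :=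
    mul_le_mul_of_nonneg_left (hS.decrease x) ha
  have h2 : inner ℝ (S x) w ≤ ‖S‖ * n * ((R + 2 * ‖T‖ * C) * a ^ 2 * (2 * n)) := by
    refine (real_inner_le_norm _ _).trans ?_
    gcongr
    refine (S.le_opNorm x).trans ?_
    gcongr
    linarith
  have h3 : inner ℝ (S y) y ≤ ‖S‖ * ((‖T‖ + C + R) * a * (2 * n)) ^ 2 := by
    refine (real_inner_le_norm _ _).trans ?_
    calc ‖S y‖ * ‖y‖ ≤ ‖S‖ * ‖y‖ * ‖y‖ := by gcongr; exact S.le_opNorm y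
      _ = ‖S‖ * ‖y‖ ^ 2 := by ring
      _ ≤ _ := by gcongr
  have hn2 : n ^ 2 ≤ 2 * (1 + ‖x‖ ^ 2) := by
    rw [hn]; nlinarith [sq_nonneg (1 - ‖x‖)]
  have h4 : ‖S‖ * n * ((R + 2 * ‖T‖ * C) * a ^ 2 * (2 * n))
      ≤ 4 * ‖S‖ * (R + 2 * ‖T‖ * C) * a ^ 2 * (1 + ‖x‖ ^ 2) := by
    calc _ = 2 * ‖S‖ * (R + 2 * ‖T‖ * C) * a ^ 2 * n ^ 2 := by ring
      _ ≤ 2 * ‖S‖ * (R + 2 * ‖T‖ * C) * a ^ 2 * (2 * (1 + ‖x‖ ^ 2)) := by gcongr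
      _ = _ := by ring
  have h5 : ‖S‖ * ((‖T‖ + C + R) * a * (2 * n)) ^ 2
      ≤ 8 * ‖S‖ * (‖T‖ + C + R) ^ 2 * a ^ 2 * (1 + ‖x‖ ^ 2) := by
    calc _ = 4 * ‖S‖ * (‖T‖ + C + R) ^ 2 * a ^ 2 * n ^ 2 := by ring
      _ ≤ 4 * ‖S‖ * (‖T‖ + C + R) ^ 2 * a ^ 2 * (2 * (1 + ‖x‖ ^ 2)) := by gcongr
      _ = _ := by ring
  rw [add_assoc x, ← hy, hexp, hxy]
  linarith

end OneStep

/-! ### The corrected error and its second moments -/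

section Recursion

variable {Ω E : Type*} {mΩ : MeasurableSpace Ω} [NormedAddCommGroup E] [InnerProductSpace ℝ E]

/-- The error recursion `e_{t+1} = e_t + α_{t+1} (T e_t + M_t e_t + m_t)` of linear stochastic
approximation, up to the telescoping correctors `H_t - H_{t+1}` and `h_t - h_{t+1}`. -/
structure IsErrorRecursion (P : Measure Ω) (𝓕 : ℕ → MeasurableSpace Ω) (α : ℕ → ℝ)
    (T : E →L[ℝ] E) (C : ℝ) (M H : ℕ → Ω → E →L[ℝ] E) (m h e : ℕ → Ω → E) : Prop where
  le : ∀ t, 𝓕 t ≤ mΩ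
  mono : Monotone 𝓕
  nonneg : 0 ≤ C
  op : IsBoundedNoise P 𝓕 C M H
  vec : IsBoundedNoise P 𝓕 C m h
  init : IsBddMeas P (𝓕 1) (e 1)
  step : ∀ t, 1 ≤ t → ∀ ω, e (t + 1) ω = e t ω + α (t + 1) • (T (e t ω) + (M t ω (e t ω) + m t ω)
    + ((H t ω - H (t + 1) ω) (e t ω) + (h t ω - h (t + 1) ω)))

/-- The error corrected by the solution of the Poisson equation. -/
def correctedError (α : ℕ → ℝ) (H : ℕ → Ω → E →L[ℝ] E) (h e : ℕ → Ω → E) (t : ℕ) (ω : Ω) : E :=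
  e t ω + α t • (H t ω (e t ω) + h t ω)

/-- The second order remainder in the recursion of the corrected error. -/
def remainder (α : ℕ → ℝ) (H : ℕ → Ω → E →L[ℝ] E) (h e : ℕ → Ω → E) (t : ℕ) (ω : Ω) : E :=
  α (t + 1) • H (t + 1) ω (e (t + 1) ω - e t ω)
    + (α (t + 1) - α t) • (H t ω (e t ω) + h t ω)

/-- `α_t - α_{t+1}` is `α_t α_{t+1}` times a bounded increment of `1/α`, and `α_t ≤ 2 α_{t+1}`. -/
lemma IsSlowlyDecreasing.exists_sub_le {α : ℕ → ℝ} (hα : IsSlowlyDecreasing α) :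
    ∃ D, 0 ≤ D ∧ ∀ t, 1 ≤ t → |α (t + 1) - α t| ≤ D * α (t + 1) ^ 2 := by
  obtain ⟨D, hD⟩ := hα.tendsto_inv_sub.bddAbove_range
  refine ⟨2 * |D|, by positivity, fun t ht => ?_⟩
  have ha := hα.pos t ht
  have hb := hα.pos (t + 1) (by omega)
  have h1 : (α (t + 1))⁻¹ - (α t)⁻¹ ≤ |D| := (hD ⟨t, rfl⟩).trans (le_abs_self D)
  have h2 := mul_le_mul_of_nonneg_right h1 (mul_pos ha hb).le
  rw [show ((α (t + 1))⁻¹ - (α t)⁻¹) * (α t * α (t + 1)) = α t - α (t + 1) by field_simp] at h2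
  rw [abs_sub_comm, abs_of_nonneg (sub_nonneg.2 (hα.anti t ht))]
  have h3 := mul_le_mul_of_nonneg_right (hα.le_two_mul t ht) hb.le
  nlinarith [mul_le_mul_of_nonneg_left h3 (abs_nonneg D)]

namespace IsErrorRecursion

variable {P : Measure Ω} {𝓕 : ℕ → MeasurableSpace Ω} {α : ℕ → ℝ}
  {T : E →L[ℝ] E} {C : ℝ} {M H : ℕ → Ω → E →L[ℝ] E} {m h e : ℕ → Ω → E}

lemma ae_bounds (he : IsErrorRecursion P 𝓕 α T C M H m h e) :
    ∀ᵐ ω ∂P, ∀ t, 1 ≤ t → ‖M t ω‖ ≤ C ∧ ‖H t ω‖ ≤ C ∧ ‖m t ω‖ ≤ C ∧ ‖h t ω‖ ≤ C := by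
  rw [ae_all_iff]
  intro t
  by_cases ht : 1 ≤ t
  · filter_upwards [he.op.bound_mart t ht, he.op.bound_corr t ht, he.vec.bound_mart t ht,
      he.vec.bound_corr t ht] with ω h1 h2 h3 h4 _
    exact ⟨h1, h2, h3, h4⟩
  · exact ae_of_all _ fun ω h => absurd h ht

lemma bddMeas_H (he : IsErrorRecursion P 𝓕 α T C M H m h e) {t : ℕ} (ht : 1 ≤ t) :
    IsBddMeas P (𝓕 t) (H t) := ⟨he.op.meas_corr t ht, C, he.op.bound_corr t ht⟩

lemma bddMeas_h (he : IsErrorRecursion P 𝓕 α T C M H m h e) {t : ℕ} (ht : 1 ≤ t) :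
    IsBddMeas P (𝓕 t) (h t) := ⟨he.vec.meas_corr t ht, C, he.vec.bound_corr t ht⟩

lemma bddMeas_M (he : IsErrorRecursion P 𝓕 α T C M H m h e) {t : ℕ} (ht : 1 ≤ t) :
    IsBddMeas P (𝓕 (t + 1)) (M t) := ⟨he.op.meas_mart t ht, C, he.op.bound_mart t ht⟩

lemma bddMeas_m (he : IsErrorRecursion P 𝓕 α T C M H m h e) {t : ℕ} (ht : 1 ≤ t) :
    IsBddMeas P (𝓕 (t + 1)) (m t) := ⟨he.vec.meas_mart t ht, C, he.vec.bound_mart t ht⟩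

/-- The bound may grow with `t`; it only serves to make every expectation below finite. -/
lemma bddMeas_e (he : IsErrorRecursion P 𝓕 α T C M H m h e) {t : ℕ} (ht : 1 ≤ t) :
    IsBddMeas P (𝓕 t) (e t) := by
  induction t, ht using Nat.le_induction with
  | base => exact he.init
  | succ t ht ih =>
    have hle : 𝓕 t ≤ 𝓕 (t + 1) := he.mono (Nat.le_succ t)
    have ih' := ih.mono hle
    have hstep : e (t + 1) = fun ω => e t ω + α (t + 1) • (T (e t ω) + (M t ω (e t ω) + m t ω)
        + ((H t ω - H (t + 1) ω) (e t ω) + (h t ω - h (t + 1) ω))) :=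
      funext fun ω => he.step t ht ω
    rw [hstep]
    exact ih'.add ((((ih'.clm_comp T).add (((he.bddMeas_M ht).clm_apply ih').add
      (he.bddMeas_m ht))).add (((((he.bddMeas_H ht).mono hle).sub
        (he.bddMeas_H (by omega))).clm_apply ih').add
          (((he.bddMeas_h ht).mono hle).sub (he.bddMeas_h (by omega))))).const_smul _)

lemma bddMeas_correctedError (he : IsErrorRecursion P 𝓕 α T C M H m h e) {t : ℕ} (ht : 1 ≤ t) :
    IsBddMeas P (𝓕 t) (correctedError α H h e t) :=
  (he.bddMeas_e ht).add ((((he.bddMeas_H ht).clm_apply (he.bddMeas_e ht)).add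
    (he.bddMeas_h ht)).const_smul _)

/-- The correction turns the first order terms `α (H_t - H_{t+1}) e_t` and `α (h_t - h_{t+1})` into
changes of `e` and of `α`, which are collected in `remainder`. -/
lemma correctedError_succ (he : IsErrorRecursion P 𝓕 α T C M H m h e) {t : ℕ} (ht : 1 ≤ t)
    (ω : Ω) : correctedError α H h e (t + 1) ω = correctedError α H h e t ω
      + α (t + 1) • (T (e t ω) + (M t ω (e t ω) + m t ω)) + remainder α H h e t ω := by
  have h1 := he.step t ht ω
  simp only [correctedError, remainder]
  generalize e (t + 1) ω = e' at h1 ⊢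
  subst h1
  simp only [map_add, map_sub, map_smul, sub_apply, smul_add, smul_sub, sub_smul]
  module

/-- One part carries `α_{t+1}` times an increment of `e`, itself of order `α_{t+1}`; the other
carries `α_{t+1} - α_t`, of order `α_{t+1}²`. -/
lemma exists_remainder_bound (he : IsErrorRecursion P 𝓕 α T C M H m h e)
    (hα : IsSlowlyDecreasing α) :
    ∃ R, 0 ≤ R ∧ ∀ᵐ ω ∂P, ∀ t, 1 ≤ t →
      ‖remainder α H h e t ω‖ ≤ R * α (t + 1) ^ 2 * (1 + ‖e t ω‖) := by
  obtain ⟨D, hD0, hD⟩ := hα.exists_sub_le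
  have hC := he.nonneg
  refine ⟨C * (‖T‖ + 3 * C) + D * C, by positivity, ?_⟩
  filter_upwards [he.ae_bounds] with ω hω t ht
  obtain ⟨hM, hH, hm, hh⟩ := hω t ht
  obtain ⟨-, hH', -, hh'⟩ := hω (t + 1) (by omega)
  have ha := (hα.pos (t + 1) (by omega)).le
  set n := 1 + ‖e t ω‖ with hn
  have hn1 : ‖e t ω‖ ≤ n := by linarith
  have hn0 : 1 ≤ n := by linarith [norm_nonneg (e t ω)]
  have hop : ∀ (L : E →L[ℝ] E) {B : ℝ}, ‖L‖ ≤ B → ‖L (e t ω)‖ ≤ B * ‖e t ω‖ := fun L B hB =>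
    (L.le_opNorm _).trans (by gcongr)
  have hdiff : ‖e (t + 1) ω - e t ω‖ ≤ α (t + 1) * ((‖T‖ + 3 * C) * n) := by
    rw [he.step t ht ω, add_sub_cancel_left, norm_smul, Real.norm_of_nonneg ha]
    gcongr
    have h1 : ‖(H t ω - H (t + 1) ω) (e t ω)‖ ≤ (C + C) * ‖e t ω‖ :=
      hop _ ((norm_sub_le _ _).trans (add_le_add hH hH'))
    have h2 : ‖h t ω - h (t + 1) ω‖ ≤ C + C := (norm_sub_le _ _).trans (add_le_add hh hh')
    have h3 := hop _ hM
    have h4 := hop T le_rfl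
    have h5 := norm_add_le (T (e t ω) + (M t ω (e t ω) + m t ω))
      ((H t ω - H (t + 1) ω) (e t ω) + (h t ω - h (t + 1) ω))
    have h6 := norm_add_le (T (e t ω)) (M t ω (e t ω) + m t ω)
    have h7 := norm_add_le (M t ω (e t ω)) (m t ω)
    have h8 := norm_add_le ((H t ω - H (t + 1) ω) (e t ω)) (h t ω - h (t + 1) ω)
    have h9 := norm_nonneg T
    rw [hn]
    nlinarith
  have hcor : ‖H t ω (e t ω) + h t ω‖ ≤ C * n := by
    have := norm_add_le (H t ω (e t ω)) (h t ω)
    have := hop _ hH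
    rw [hn]; linarith
  calc ‖remainder α H h e t ω‖
      ≤ α (t + 1) * (C * (α (t + 1) * ((‖T‖ + 3 * C) * n))) + D * α (t + 1) ^ 2 * (C * n) := by
        refine (norm_add_le _ _).trans (add_le_add ?_ ?_)
        · rw [norm_smul, Real.norm_of_nonneg ha]
          gcongr
          exact (ContinuousLinearMap.le_opNorm _ _).trans
            (mul_le_mul hH' hdiff (norm_nonneg _) hC)
        · rw [norm_smul]
          gcongr
          exact hD t ht
    _ = _ := by ring

lemma ae_correctedError_sub_le (he : IsErrorRecursion P 𝓕 α T C M H m h e)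
    (hα : IsSlowlyDecreasing α) :
    ∀ᵐ ω ∂P, ∀ t, 1 ≤ t →
      ‖correctedError α H h e t ω - e t ω‖ ≤ α t * (C * (1 + ‖e t ω‖)) := by
  filter_upwards [he.ae_bounds] with ω hω t ht
  obtain ⟨-, hH, -, hh⟩ := hω t ht
  rw [correctedError, add_sub_cancel_left, norm_smul, Real.norm_of_nonneg (hα.pos t ht).le]
  have ha := (hα.pos t ht).le
  gcongr
  have h1 := norm_add_le (H t ω (e t ω)) (h t ω)
  have h2 := (H t ω).le_opNorm (e t ω)
  have h3 := mul_le_mul_of_nonneg_right hH (norm_nonneg (e t ω))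
  linarith

variable [IsProbabilityMeasure P] [CompleteSpace E]

lemma integral_inner_mart_op (he : IsErrorRecursion P 𝓕 α T C M H m h e) {t : ℕ} (ht : 1 ≤ t)
    {y : Ω → E} (hy : IsBddMeas P (𝓕 t) y) :
    ∫ ω, inner ℝ (y ω) (M t ω (e t ω)) ∂P = 0 := by
  have hle : 𝓕 t ≤ 𝓕 (t + 1) := he.mono (Nat.le_succ t)
  have hint := ((hy.mono hle).inner ((he.bddMeas_M ht).clm_apply
    ((he.bddMeas_e ht).mono hle))).integrable (he.le _)
  -- `⟪y, M e⟫` is read as the functional `L ↦ ⟪y, L e⟫`, measurable at time `t`, applied to the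
  -- centred operator `M t`.
  have hcont : Continuous fun p : E × E =>
      (innerSL ℝ p.1).comp (ContinuousLinearMap.apply ℝ E p.2) := by fun_prop
  exact integral_clm_apply_eq_zero (he.le t) ((he.bddMeas_M ht).integrable (he.le _))
    (he.op.centered t ht) (hcont.comp_stronglyMeasurable (hy.1.prodMk (he.bddMeas_e ht).1)) hint

lemma integral_inner_mart_vec (he : IsErrorRecursion P 𝓕 α T C M H m h e) {t : ℕ} (ht : 1 ≤ t)
    {y : Ω → E} (hy : IsBddMeas P (𝓕 t) y) :
    ∫ ω, inner ℝ (y ω) (m t ω) ∂P = 0 := by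
  have hle : 𝓕 t ≤ 𝓕 (t + 1) := he.mono (Nat.le_succ t)
  have hint := ((hy.mono hle).inner (he.bddMeas_m ht)).integrable (he.le _)
  have hcont : Continuous fun p : E => innerSL ℝ p := by fun_prop
  exact integral_clm_apply_eq_zero (he.le t) ((he.bddMeas_m ht).integrable (he.le _))
    (he.vec.centered t ht) (hcont.comp_stronglyMeasurable hy.1) hint

/-- Second moment bound for the corrected error. -/
theorem exists_second_moment_bound (he : IsErrorRecursion P 𝓕 α T C M H m h e)
    (hα : IsSlowlyDecreasing α) {S : E →L[ℝ] E} {c : ℝ} (hS : IsLyapunov T S c) :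
    ∃ K, 0 ≤ K ∧ (∀ t, 1 ≤ t → ∫ ω, ‖correctedError α H h e t ω‖ ^ 2 ∂P ≤ K * α t) ∧
      ∀ t, 1 ≤ t → ∫ ω, ‖e t ω‖ ^ 2 ∂P ≤ K := by
  obtain ⟨R, hR0, hR⟩ := he.exists_remainder_bound hα
  obtain ⟨K, hK0, hK⟩ := hS.one_step he.nonneg hR0
  have hc := hS.pos
  set x := correctedError α H h e with hx
  have hxm : ∀ t, 1 ≤ t → IsBddMeas P (𝓕 t) (x t) := fun t ht => he.bddMeas_correctedError ht
  have hα' := hα.tendsto_zero.comp (tendsto_add_atTop_nat 1)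
  have hsmall : ∀ᶠ t in atTop, 1 ≤ t ∧ α (t + 1) ≤ 1 ∧ α t * C ≤ 1 / 2 ∧ K * α (t + 1) ≤ c := by
    have h1 : Tendsto (fun t => α t * C) atTop (𝓝 0) := by
      simpa using hα.tendsto_zero.mul_const C
    have h2 : Tendsto (fun t => K * α (t + 1)) atTop (𝓝 0) := by
      simpa using hα'.const_mul K
    filter_upwards [eventually_ge_atTop 1, hα'.eventually_le_const one_pos,
      h1.eventually_le_const (show (0 : ℝ) < 1 / 2 by norm_num), h2.eventually_le_const hc]
      with t h1 h2 h3 h4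
    exact ⟨h1, h2, h3, h4⟩
  -- Of the drift `-2cα‖x‖²`, one half absorbs `Kα²‖x‖²` once `Kα ≤ c`; the other becomes a
  -- contraction of the quadratic form, which is at most `(‖S‖ + 1)‖x‖²`.
  have hstep : ∀ᶠ t in atTop, ∀ᵐ ω ∂P, ‖e t ω‖ ≤ 2 * ‖x t ω‖ + 1 ∧
      inner ℝ (S (x (t + 1) ω)) (x (t + 1) ω)
        ≤ (1 - c / (‖S‖ + 1) * α (t + 1)) * inner ℝ (S (x t ω)) (x t ω) + K * α (t + 1) ^ 2
          + 2 * α (t + 1) * (inner ℝ (S (x t ω)) (M t ω (e t ω))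
            + inner ℝ (S (x t ω)) (m t ω)) := by
    filter_upwards [hsmall] with t ht
    obtain ⟨ht1, ha1, haC, hKc⟩ := ht
    filter_upwards [he.ae_bounds, hR, he.ae_correctedError_sub_le hα] with ω h1 h2 h3
    obtain ⟨hM, -, hm, -⟩ := h1 t ht1
    have ha := hα.pos (t + 1) (by omega)
    have hN : ‖M t ω (e t ω) + m t ω‖ ≤ C * (1 + ‖e t ω‖) := by
      have h4 := norm_add_le (M t ω (e t ω)) (m t ω)
      have h5 := (M t ω).le_opNorm (e t ω)
      have h6 := mul_le_mul_of_nonneg_right hM (norm_nonneg (e t ω))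
      linarith
    obtain ⟨h4, h5⟩ := hK (α (t + 1)) (α t) (x t ω) (e t ω) _ _ ha.le ha1 (hα.le_two_mul t ht1)
      haC (h3 t ht1) hN (h2 t ht1)
    refine ⟨h4, ?_⟩
    rw [← he.correctedError_succ ht1 ω, inner_add_right] at h5
    refine h5.trans ?_
    have h6 : inner ℝ (S (x t ω)) (x t ω) ≤ (‖S‖ + 1) * ‖x t ω‖ ^ 2 := by
      refine (real_inner_le_norm _ _).trans ?_
      have := mul_le_mul_of_nonneg_right (S.le_opNorm (x t ω)) (norm_nonneg (x t ω))
      nlinarith [sq_nonneg ‖x t ω‖]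
    have h7 : c / (‖S‖ + 1) * α (t + 1) * inner ℝ (S (x t ω)) (x t ω)
        ≤ c * α (t + 1) * ‖x t ω‖ ^ 2 := by
      calc _ ≤ c / (‖S‖ + 1) * α (t + 1) * ((‖S‖ + 1) * ‖x t ω‖ ^ 2) := by gcongr
        _ = _ := by field_simp
    have h8 : K * α (t + 1) ^ 2 * ‖x t ω‖ ^ 2 ≤ c * α (t + 1) * ‖x t ω‖ ^ 2 := by
      rw [pow_two, ← mul_assoc]
      gcongr
    linarith
  have hV : ∀ t, 1 ≤ t → IsBddMeas P (𝓕 t) (fun ω => inner ℝ (S (x t ω)) (x t ω)) :=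
    fun t ht => ((hxm t ht).clm_comp S).inner (hxm t ht)
  have hrec : ∀ᶠ t in atTop, ∫ ω, inner ℝ (S (x (t + 1) ω)) (x (t + 1) ω) ∂P
      ≤ (1 - c / (‖S‖ + 1) * α (t + 1)) * ∫ ω, inner ℝ (S (x t ω)) (x t ω) ∂P
        + K * α (t + 1) ^ 2 := by
    filter_upwards [hstep, eventually_ge_atTop 1] with t ht ht1
    have hle : 𝓕 t ≤ 𝓕 (t + 1) := he.mono (Nat.le_succ t)
    have hSx := (hxm t ht1).clm_comp S
    have i1 := (hV (t + 1) (by omega)).integrable (he.le _)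
    have i2 := (hV t ht1).integrable (he.le _)
    have i3 := ((hSx.mono hle).inner ((he.bddMeas_M ht1).clm_apply
      ((he.bddMeas_e ht1).mono hle))).integrable (he.le _)
    have i4 := ((hSx.mono hle).inner (he.bddMeas_m ht1)).integrable (he.le _)
    have i5 := (i2.const_mul (1 - c / (‖S‖ + 1) * α (t + 1))).add
      (integrable_const (μ := P) (K * α (t + 1) ^ 2))
    have i6 := (i3.add i4).const_mul (2 * α (t + 1))
    have h1 := integral_mono_ae i1 (i5.add i6) (ht.mono fun ω hω => hω.2)
    refine h1.trans (le_of_eq ?_)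
    rw [integral_add' i5 i6, integral_add' (i2.const_mul _) (integrable_const _),
      integral_const_mul (1 - _), integral_const_mul (2 * α (t + 1)), integral_add' i3 i4,
      he.integral_inner_mart_op ht1 hSx, he.integral_inner_mart_vec ht1 hSx]
    simp
  obtain ⟨K₁, hK₁, hbound⟩ := hα.le_mul_of_recursion
    (v := fun t => ∫ ω, inner ℝ (S (x t ω)) (x t ω) ∂P) (show 0 < c / (‖S‖ + 1) by positivity) hK0 hrec
  have hx2 : ∀ t, 1 ≤ t → ∫ ω, ‖x t ω‖ ^ 2 ∂P ≤ K₁ * α t := fun t ht =>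
    (integral_mono ((hxm t ht).norm_sq.integrable (he.le _)) ((hV t ht).integrable (he.le _))
      fun ω => hS.coercive (x t ω)).trans (hbound t ht)
  -- From `‖e‖ ≤ 2‖x‖ + 1` comes `‖e‖² ≤ 8‖x‖² + 2`. The finitely many earlier times are then
  -- covered because an eventually bounded real sequence is bounded above.
  have hebd : ∀ᶠ t in atTop, ∫ ω, ‖e t ω‖ ^ 2 ∂P ≤ 8 * K₁ + 2 := by
    filter_upwards [hstep, eventually_ge_atTop 1, hα.tendsto_zero.eventually_le_const one_pos]
      with t ht ht1 ha1
    have i1 := (he.bddMeas_e ht1).norm_sq.integrable (he.le t)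
    have i2 := (hxm t ht1).norm_sq.integrable (he.le t)
    have h1 := integral_mono_ae i1 ((i2.const_mul 8).add (integrable_const (2 : ℝ)))
      (ht.mono fun ω hω => by
        have h2 := hω.1
        have h3 := norm_nonneg (e t ω)
        simp only [Pi.add_apply]
        nlinarith [sq_nonneg (2 * ‖x t ω‖ - 1)])
    rw [integral_add' (i2.const_mul 8) (integrable_const _), integral_const_mul] at h1
    have h2 := hx2 t ht1
    have h3 := mul_le_mul_of_nonneg_left ha1 hK₁
    simp only [integral_const, probReal_univ, smul_eq_mul, one_mul] at h1
    linarith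
  obtain ⟨B, hB⟩ := (isBoundedUnder_of_eventually_le hebd).bddAbove_range
  refine ⟨max K₁ B, le_max_of_le_left hK₁, fun t ht => (hx2 t ht).trans ?_, fun t ht =>
    (hB ⟨t, rfl⟩).trans (le_max_right _ _)⟩
  have := (hα.pos t ht).le
  gcongr
  exact le_max_left _ _

end IsErrorRecursion

end Recursion

/-! ### Summing the recursion: the averaged error -/

namespace IsErrorRecursion

variable {Ω E : Type*} {mΩ : MeasurableSpace Ω} [NormedAddCommGroup E] [InnerProductSpace ℝ E]
  {P : Measure Ω} {𝓕 : ℕ → MeasurableSpace Ω} {α : ℕ → ℝ}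
  {T : E →L[ℝ] E} {C : ℝ} {M H : ℕ → Ω → E →L[ℝ] E} {m h e : ℕ → Ω → E}

/-- Dividing the corrected recursion by `α_{i+1}` isolates `T e_i + m_i`; the increments of the
corrected error are then summed by parts. -/
lemma sum_eq (he : IsErrorRecursion P 𝓕 α T C M H m h e) (hα : IsSlowlyDecreasing α) (t : ℕ)
    (ω : Ω) : ∑ i ∈ Finset.Icc 1 t, (T (e i ω) + m i ω + (h i ω - h (i + 1) ω))
      = ((α (t + 1))⁻¹ • correctedError α H h e (t + 1) ω - (α 1)⁻¹ • correctedError α H h e 1 ω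
          - ∑ i ∈ Finset.Icc 1 t, ((α (i + 1))⁻¹ - (α i)⁻¹) • correctedError α H h e i ω)
        - ∑ i ∈ Finset.Icc 1 t, (α (i + 1))⁻¹ • remainder α H h e i ω
        - ∑ i ∈ Finset.Icc 1 t, M i ω (e i ω) + (h 1 ω - h (t + 1) ω) := by
  have htel : h 1 ω - h (t + 1) ω = ∑ i ∈ Finset.Icc 1 t, (h i ω - h (i + 1) ω) := by
    induction t with
    | zero => simp
    | succ t ih => rw [Finset.sum_Icc_succ_top (by omega), ← ih]; abel
  rw [← summation_by_parts (fun i => (α i)⁻¹) (fun i => correctedError α H h e i ω), htel,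
    ← Finset.sum_sub_distrib, ← Finset.sum_sub_distrib, ← Finset.sum_add_distrib]
  refine Finset.sum_congr rfl fun i hi => ?_
  have hi1 := (Finset.mem_Icc.1 hi).1
  have ha := (hα.pos (i + 1) (by omega)).ne'
  rw [he.correctedError_succ hi1 ω, add_sub_right_comm, add_sub_cancel_left, smul_add, smul_smul,
    inv_mul_cancel₀ ha, one_smul]
  abel

variable [IsProbabilityMeasure P] [CompleteSpace E]

/-- The correction is of order `α_t (1 + ‖e_t‖)` and `E‖e_t‖²` is already bounded, so the rate `α_t`
passes from the corrected error to the error. -/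
lemma exists_error_second_moment_bound (he : IsErrorRecursion P 𝓕 α T C M H m h e)
    (hα : IsSlowlyDecreasing α) {S : E →L[ℝ] E} {c : ℝ} (hS : IsLyapunov T S c) :
    ∃ K, 0 ≤ K ∧ (∀ t, 1 ≤ t → ∫ ω, ‖correctedError α H h e t ω‖ ∂P ≤ K * √(α t)) ∧
      (∀ t, 1 ≤ t → ∫ ω, ‖e t ω‖ ∂P ≤ K) ∧ ∀ t, 1 ≤ t → ∫ ω, ‖e t ω‖ ^ 2 ∂P ≤ K * α t := by
  obtain ⟨K, hK0, hx, hee⟩ := he.exists_second_moment_bound hα hS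
  have hC := he.nonneg
  have hα1 : ∀ t, 1 ≤ t → α t ≤ α 1 := fun t ht => by
    induction t, ht using Nat.le_induction with
    | base => exact le_rfl
    | succ t ht ih => exact (hα.anti t ht).trans ih
  have h1pos := hα.pos 1 le_rfl
  refine ⟨K + 1 + (2 * K + 4 * α 1 * C ^ 2 * (1 + K)), by positivity,
    fun t ht => ?_, fun t ht => ?_, fun t ht => ?_⟩
  · have ha := hα.pos t ht
    have hs := Real.sqrt_pos.2 ha
    have hb := he.bddMeas_correctedError ht
    -- The pointwise inequality `u ≤ u²/s + s` with `s = √(α t)` replaces Cauchy–Schwarz.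
    have h1 : ∫ ω, ‖correctedError α H h e t ω‖ ∂P
        ≤ ∫ ω, ((√(α t))⁻¹ * ‖correctedError α H h e t ω‖ ^ 2 + √(α t)) ∂P := by
      refine integral_mono (hb.norm.integrable (he.le t))
        (((hb.norm_sq.integrable (he.le t)).const_mul _).add (integrable_const _)) fun ω => ?_
      simp only
      rw [← sub_le_iff_le_add, inv_mul_eq_div, le_div_iff₀ hs]
      nlinarith [sq_nonneg (‖correctedError α H h e t ω‖ - √(α t))]
    rw [integral_add ((hb.norm_sq.integrable (he.le t)).const_mul _) (integrable_const _),
      integral_const_mul, integral_const, probReal_univ, one_smul] at h1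
    have h2 := mul_le_mul_of_nonneg_left (hx t ht) (inv_pos.2 hs).le
    have h3 : (√(α t))⁻¹ * (K * α t) = K * √(α t) := by
      nth_rw 2 [← Real.mul_self_sqrt ha.le]
      field_simp
    have h4 : 0 ≤ (2 * K + 4 * α 1 * C ^ 2 * (1 + K)) * √(α t) := by positivity
    linarith
  · have hb := he.bddMeas_e ht
    have h1 : ∫ ω, ‖e t ω‖ ∂P ≤ ∫ ω, (‖e t ω‖ ^ 2 + 1) ∂P := by
      refine integral_mono (hb.norm.integrable (he.le t))
        ((hb.norm_sq.integrable (he.le t)).add (integrable_const _)) fun ω => ?_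
      simp only
      nlinarith [sq_nonneg (‖e t ω‖ - 1), norm_nonneg (e t ω)]
    rw [integral_add (hb.norm_sq.integrable (he.le t)) (integrable_const _),
      integral_const, probReal_univ, one_smul] at h1
    have h2 := hee t ht
    have h4 : 0 ≤ 2 * K + 4 * α 1 * C ^ 2 * (1 + K) := by positivity
    linarith
  · have ha := hα.pos t ht
    have hb := he.bddMeas_e ht
    have hbx := he.bddMeas_correctedError ht
    have i1 := (hbx.norm_sq.integrable (he.le t)).const_mul 2
    have i2 := ((integrable_const (μ := P) (1 : ℝ)).add
      (hb.norm_sq.integrable (he.le t))).const_mul (4 * α t ^ 2 * C ^ 2)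
    have h1 := integral_mono_ae (hb.norm_sq.integrable (he.le t)) (i1.add i2) (by
      filter_upwards [he.ae_correctedError_sub_le hα] with ω hω
      have h2 := hω t ht
      have h3 : ‖e t ω‖ ≤ ‖correctedError α H h e t ω‖ + α t * (C * (1 + ‖e t ω‖)) := by
        have := norm_sub_le (correctedError α H h e t ω) (correctedError α H h e t ω - e t ω)
        rw [sub_sub_cancel] at this
        linarith
      have h4 : ‖e t ω‖ ^ 2 ≤ (‖correctedError α H h e t ω‖ + α t * (C * (1 + ‖e t ω‖))) ^ 2 := by
        gcongr
      have h5 : (‖correctedError α H h e t ω‖ + α t * (C * (1 + ‖e t ω‖))) ^ 2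
          ≤ 2 * ‖correctedError α H h e t ω‖ ^ 2 + 2 * (α t * (C * (1 + ‖e t ω‖))) ^ 2 := by
        nlinarith [sq_nonneg (‖correctedError α H h e t ω‖ - α t * (C * (1 + ‖e t ω‖)))]
      have h6 : 2 * (α t * (C * (1 + ‖e t ω‖))) ^ 2
          ≤ 4 * α t ^ 2 * C ^ 2 * (1 + ‖e t ω‖ ^ 2) := by
        have h7 : (1 + ‖e t ω‖) ^ 2 ≤ 2 * (1 + ‖e t ω‖ ^ 2) := by
          nlinarith [sq_nonneg (1 - ‖e t ω‖)]
        calc _ = 2 * α t ^ 2 * C ^ 2 * (1 + ‖e t ω‖) ^ 2 := by ring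
          _ ≤ 2 * α t ^ 2 * C ^ 2 * (2 * (1 + ‖e t ω‖ ^ 2)) := by gcongr
          _ = _ := by ring
      simp only [Pi.add_apply]
      linarith)
    rw [integral_add' i1 i2, integral_const_mul, integral_const_mul,
      integral_add' (integrable_const _) (hb.norm_sq.integrable (he.le t)), integral_const,
      probReal_univ, one_smul] at h1
    have h2 := hx t ht
    have h3 : 4 * α t ^ 2 * C ^ 2 * (1 + ∫ ω, ‖e t ω‖ ^ 2 ∂P)
        ≤ 4 * (α 1 * α t) * C ^ 2 * (1 + K) := by
      have := hα1 t ht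
      have h5 : α t ^ 2 ≤ α 1 * α t := by nlinarith
      have h6 := hee t ht
      have h7 : 0 ≤ ∫ ω, ‖e t ω‖ ^ 2 ∂P := integral_nonneg fun _ => by positivity
      gcongr
    have h4 : 0 ≤ (K + 1) * α t := by positivity
    linarith

/-- Martingale differences are orthogonal, so the second moments, each at most `C² K α_i`, add up.
-/
lemma integral_norm_sq_sum_mart_le (he : IsErrorRecursion P 𝓕 α T C M H m h e) {K : ℝ}
    (hK : ∀ t, 1 ≤ t → ∫ ω, ‖e t ω‖ ^ 2 ∂P ≤ K * α t) (t : ℕ) :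
    ∫ ω, ‖∑ i ∈ Finset.Icc 1 t, M i ω (e i ω)‖ ^ 2 ∂P ≤ C ^ 2 * K * ∑ i ∈ Finset.Icc 1 t, α i := by
  have hterm : ∀ i, 1 ≤ i → IsBddMeas P (𝓕 (i + 1)) (fun ω => M i ω (e i ω)) := fun i hi =>
    (he.bddMeas_M hi).clm_apply ((he.bddMeas_e hi).mono (he.mono (Nat.le_succ i)))
  have hsum : ∀ t, IsBddMeas P (𝓕 (t + 1)) (fun ω => ∑ i ∈ Finset.Icc 1 t, M i ω (e i ω)) :=
    fun t => IsBddMeas.sum fun i hi =>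
      (hterm i (Finset.mem_Icc.1 hi).1).mono (he.mono (by have := (Finset.mem_Icc.1 hi).2; omega))
  induction t with
  | zero => simp
  | succ t ih =>
    have hle : 𝓕 (t + 1) ≤ 𝓕 (t + 1 + 1) := he.mono (Nat.le_succ _)
    have hb := hterm (t + 1) (by omega)
    have i1 := (hsum t).norm_sq.integrable (he.le _)
    have i2 := (((hsum t).mono hle).inner hb).integrable (he.le _)
    have i3 := hb.norm_sq.integrable (he.le _)
    have h1 : ∫ ω, ‖M (t + 1) ω (e (t + 1) ω)‖ ^ 2 ∂P ≤ C ^ 2 * (K * α (t + 1)) := by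
      refine le_trans ?_ (mul_le_mul_of_nonneg_left (hK (t + 1) (by omega)) (sq_nonneg C))
      rw [← integral_const_mul]
      refine integral_mono_ae i3
        (((he.bddMeas_e (by omega)).norm_sq.integrable (he.le (t + 1))).const_mul _) ?_
      filter_upwards [he.op.bound_mart (t + 1) (by omega)] with ω hω
      rw [← mul_pow]
      gcongr
      exact (ContinuousLinearMap.le_opNorm _ _).trans (by gcongr)
    simp_rw [Finset.sum_Icc_succ_top (show 1 ≤ t + 1 by omega), norm_add_sq_real]
    have i12 : Integrable (fun ω => ‖∑ i ∈ Finset.Icc 1 t, M i ω (e i ω)‖ ^ 2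
        + 2 * inner ℝ (∑ i ∈ Finset.Icc 1 t, M i ω (e i ω)) (M (t + 1) ω (e (t + 1) ω))) P :=
      i1.add (i2.const_mul 2)
    rw [integral_add i12 i3, integral_add i1 (i2.const_mul 2),
      integral_const_mul, he.integral_inner_mart_op (by omega) (hsum t)]
    linarith

/-- The averaged linear part of the error recursion is `o(1)` in `L¹` after scaling by `√t`. -/
theorem tendsto_integral_norm (he : IsErrorRecursion P 𝓕 α T C M H m h e)
    (hα : IsSlowlyDecreasing α) {S : E →L[ℝ] E} {c : ℝ} (hS : IsLyapunov T S c) :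
    Tendsto (fun t : ℕ => (√t)⁻¹ * ∫ ω, ‖∑ i ∈ Finset.Icc 1 t,
      (T (e i ω) + m i ω + (h i ω - h (i + 1) ω))‖ ∂P) atTop (𝓝 0) := by
  obtain ⟨K, hK0, hx, he1, he2⟩ := he.exists_error_second_moment_bound hα hS
  obtain ⟨R, hR0, hR⟩ := he.exists_remainder_bound hα
  -- The terms are, in order: Abel summation; remainders together with the martingale sum; and the
  -- boundary term `2C`, plus the 1 from `‖n‖ ≤ ‖n‖² + 1`. That crude inequality suffices since `∑
  -- α_i` is already `o(√t)`.
  have hbound : ∀ t : ℕ, ∫ ω, ‖∑ i ∈ Finset.Icc 1 t,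
      (T (e i ω) + m i ω + (h i ω - h (i + 1) ω))‖ ∂P
      ≤ 5 * K * (√(α (t + 1)))⁻¹ + (R * (1 + K) + C ^ 2 * K) * ∑ i ∈ Finset.Icc 1 t, α i
        + (1 + 2 * C) := by
    intro t
    set x := correctedError α H h e with hxdef
    have bx : ∀ i, 1 ≤ i → Integrable (fun ω => ‖x i ω‖) P := fun i hi =>
      (he.bddMeas_correctedError hi).norm.integrable (he.le i)
    have bN : Integrable (fun ω => ‖∑ i ∈ Finset.Icc 1 t, M i ω (e i ω)‖ ^ 2) P := by
      refine (IsBddMeas.norm_sq (m := 𝓕 (t + 1)) (IsBddMeas.sum fun i hi => ?_)).integrable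
        (he.le _)
      have hi' := Finset.mem_Icc.1 hi
      exact ((he.bddMeas_M hi'.1).mono (he.mono (by omega))).clm_apply
        ((he.bddMeas_e hi'.1).mono (he.mono (by omega)))
    have be : ∀ i, 1 ≤ i → Integrable (fun ω => ‖e i ω‖) P := fun i hi =>
      (he.bddMeas_e hi).norm.integrable (he.le i)
    have j1 : Integrable (fun ω => (α (t + 1))⁻¹ * ‖x (t + 1) ω‖ + (α 1)⁻¹ * ‖x 1 ω‖) P :=
      ((bx _ (by omega)).const_mul _).add ((bx _ le_rfl).const_mul _)
    have j2 : ∀ i ∈ Finset.Icc 1 t,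
        Integrable (fun ω => ((α (i + 1))⁻¹ - (α i)⁻¹) * ‖x i ω‖) P := fun i hi =>
      (bx i (Finset.mem_Icc.1 hi).1).const_mul _
    have j3 : ∀ i ∈ Finset.Icc 1 t, Integrable (fun ω => R * α i * (1 + ‖e i ω‖)) P :=
      fun i hi => ((integrable_const _).add (be i (Finset.mem_Icc.1 hi).1)).const_mul _
    have j4 : Integrable (fun ω => ‖∑ i ∈ Finset.Icc 1 t, M i ω (e i ω)‖ ^ 2 + (1 + 2 * C)) P :=
      bN.add (integrable_const _)
    have hpt : ∀ᵐ ω ∂P, ‖∑ i ∈ Finset.Icc 1 t, (T (e i ω) + m i ω + (h i ω - h (i + 1) ω))‖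
        ≤ (α (t + 1))⁻¹ * ‖x (t + 1) ω‖ + (α 1)⁻¹ * ‖x 1 ω‖
          + ∑ i ∈ Finset.Icc 1 t, ((α (i + 1))⁻¹ - (α i)⁻¹) * ‖x i ω‖
          + ∑ i ∈ Finset.Icc 1 t, R * α i * (1 + ‖e i ω‖)
          + (‖∑ i ∈ Finset.Icc 1 t, M i ω (e i ω)‖ ^ 2 + (1 + 2 * C)) := by
      filter_upwards [hR, he.ae_bounds] with ω hω hb
      rw [he.sum_eq hα t ω]
      have e1 : ∀ i, 1 ≤ i → 0 < (α i)⁻¹ := fun i hi => inv_pos.2 (hα.pos i hi)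
      have g1 : ‖(α (t + 1))⁻¹ • x (t + 1) ω‖ = (α (t + 1))⁻¹ * ‖x (t + 1) ω‖ := by
        rw [norm_smul, Real.norm_of_nonneg (e1 _ (by omega)).le]
      have g2 : ‖(α 1)⁻¹ • x 1 ω‖ = (α 1)⁻¹ * ‖x 1 ω‖ := by
        rw [norm_smul, Real.norm_of_nonneg (e1 _ le_rfl).le]
      have g3 : ‖∑ i ∈ Finset.Icc 1 t, ((α (i + 1))⁻¹ - (α i)⁻¹) • x i ω‖
          ≤ ∑ i ∈ Finset.Icc 1 t, ((α (i + 1))⁻¹ - (α i)⁻¹) * ‖x i ω‖ := by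
        refine norm_sum_le_of_le _ fun i hi => ?_
        have hi1 := (Finset.mem_Icc.1 hi).1
        rw [norm_smul, Real.norm_of_nonneg (sub_nonneg.2
          (inv_anti₀ (hα.pos _ (by omega)) (hα.anti i hi1)))]
      have g4 : ‖∑ i ∈ Finset.Icc 1 t, (α (i + 1))⁻¹ • remainder α H h e i ω‖
          ≤ ∑ i ∈ Finset.Icc 1 t, R * α i * (1 + ‖e i ω‖) := by
        refine norm_sum_le_of_le _ fun i hi => ?_
        have hi1 := (Finset.mem_Icc.1 hi).1
        have ha := hα.pos (i + 1) (by omega)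
        rw [norm_smul, Real.norm_of_nonneg (e1 _ (by omega)).le]
        calc (α (i + 1))⁻¹ * ‖remainder α H h e i ω‖
            ≤ (α (i + 1))⁻¹ * (R * α (i + 1) ^ 2 * (1 + ‖e i ω‖)) := by
              gcongr
              exact hω i hi1
          _ = R * α (i + 1) * (1 + ‖e i ω‖) := by field_simp
          _ ≤ _ := by
              gcongr
              exact hα.anti i hi1
      have g5 : ‖h 1 ω - h (t + 1) ω‖ ≤ C + C :=
        (norm_sub_le _ _).trans (add_le_add (hb 1 le_rfl).2.2.2 (hb (t + 1) (by omega)).2.2.2)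
      set a := (α (t + 1))⁻¹ • x (t + 1) ω
      set b := (α 1)⁻¹ • x 1 ω
      set d := ∑ i ∈ Finset.Icc 1 t, ((α (i + 1))⁻¹ - (α i)⁻¹) • x i ω
      set r := ∑ i ∈ Finset.Icc 1 t, (α (i + 1))⁻¹ • remainder α H h e i ω
      set n := ∑ i ∈ Finset.Icc 1 t, M i ω (e i ω)
      have k1 := norm_add_le (a - b - d - r - n) (h 1 ω - h (t + 1) ω)
      have k2 := norm_sub_le (a - b - d - r) n
      have k3 := norm_sub_le (a - b - d) r
      have k4 := norm_sub_le (a - b) d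
      have k5 := norm_sub_le a b
      have k6 : ‖n‖ ≤ ‖n‖ ^ 2 + 1 := by nlinarith [sq_nonneg (‖n‖ - 1), norm_nonneg n]
      linarith
    have j12 := j1.add (integrable_finsetSum _ j2)
    have j123 := j12.add (integrable_finsetSum _ j3)
    have h1 := integral_mono_of_nonneg (ae_of_all _ fun ω => norm_nonneg _) (j123.add j4)
      (hpt.mono fun ω hω => by
        simp only [Pi.add_apply]
        exact hω)
    refine h1.trans ?_
    rw [integral_add' j123 j4, integral_add' j12 (integrable_finsetSum _ j3),
      integral_add' j1 (integrable_finsetSum _ j2), integral_finsetSum _ j2,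
      integral_finsetSum _ j3,
      integral_add ((bx _ (by omega)).const_mul _) ((bx _ le_rfl).const_mul _),
      integral_add bN (integrable_const _), integral_const_mul, integral_const_mul,
      integral_const, probReal_univ, one_smul]
    simp_rw [integral_const_mul]
    have l1 := hα.summation_by_parts_bound hK0 hx t
    have l2 := he.integral_norm_sq_sum_mart_le he2 t
    have l3 : ∑ i ∈ Finset.Icc 1 t, R * α i * ∫ ω, (1 + ‖e i ω‖) ∂P
        ≤ R * (1 + K) * ∑ i ∈ Finset.Icc 1 t, α i := by
      rw [Finset.mul_sum]
      refine Finset.sum_le_sum fun i hi => ?_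
      have hi1 := (Finset.mem_Icc.1 hi).1
      have ha := hα.pos i hi1
      rw [integral_add (integrable_const _) (be i hi1), integral_const, probReal_univ, one_smul]
      have := he1 i hi1
      calc _ ≤ R * α i * (1 + K) := by gcongr
        _ = _ := by ring
    linarith
  have hlim : Tendsto (fun t : ℕ => 5 * K * ((√t)⁻¹ * (√(α (t + 1)))⁻¹)
      + (R * (1 + K) + C ^ 2 * K) * ((√t)⁻¹ * ∑ i ∈ Finset.Icc 1 t, α i)
      + (1 + 2 * C) * (√t)⁻¹) atTop (𝓝 0) := by
    have h1 : Tendsto (fun t : ℕ => (√(t : ℝ))⁻¹) atTop (𝓝 0) :=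
      (Real.tendsto_sqrt_atTop.comp tendsto_natCast_atTop_atTop).inv_tendsto_atTop
    simpa using ((hα.tendsto_inv_sqrt.const_mul (5 * K)).add
      (hα.tendsto_sum.const_mul (R * (1 + K) + C ^ 2 * K))).add (h1.const_mul (1 + 2 * C))
  refine squeeze_zero (fun t => mul_nonneg (by positivity)
    (integral_nonneg fun _ => norm_nonneg _)) (fun t => ?_) hlim
  refine (mul_le_mul_of_nonneg_left (hbound t) (by positivity)).trans (le_of_eq ?_)
  ring

end IsErrorRecursion

/-! ### Auxiliary facts on noise bounds, `o_p(1)` terms and matrices -/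

lemma IsBoundedNoise.mono {Ω F : Type*} {mΩ : MeasurableSpace Ω} [NormedAddCommGroup F]
    [NormedSpace ℝ F] {P : Measure Ω} {𝓕 : ℕ → MeasurableSpace Ω} {C C' : ℝ} {M H : ℕ → Ω → F}
    (hM : IsBoundedNoise P 𝓕 C M H) (hC : C ≤ C') : IsBoundedNoise P 𝓕 C' M H where
  meas_corr := hM.meas_corr
  meas_mart := hM.meas_mart
  bound_corr t ht := (hM.bound_corr t ht).mono fun _ h => h.trans hC
  bound_mart t ht := (hM.bound_mart t ht).mono fun _ h => h.trans hC
  centered := hM.centered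

lemma EqUpToLittleOp.sub {Ω : Type*} [MeasurableSpace Ω] {d : ℕ} {P : Measure Ω}
    {U V U' V' : ℕ → Ω → EuclideanSpace ℝ (Fin d)} (h : EqUpToLittleOp P U V)
    (h' : EqUpToLittleOp P U' V') :
    EqUpToLittleOp P (fun t ω => U t ω - U' t ω) (fun t ω => V t ω - V' t ω) := by
  intro ε hε
  have hε2 : 0 < ε / 2 := ENNReal.half_pos hε.ne'
  have hsum := (h _ hε2).add (h' _ hε2)
  rw [add_zero] at hsum
  refine tendsto_of_tendsto_of_tendsto_of_le_of_le tendsto_const_nhds hsum (fun _ => zero_le)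
    fun t => (measure_mono fun ω hω => ?_).trans (measure_union_le _ _)
  by_contra hcon
  simp only [Set.mem_union, Set.mem_ofPred_eq, not_or, not_le, edist_zero_right] at hcon hω
  refine absurd hω (not_le.2 ?_)
  calc ‖U t ω - U' t ω - (V t ω - V' t ω)‖ₑ = ‖(U t ω - V t ω) - (U' t ω - V' t ω)‖ₑ := by
        congr 1; abel
    _ ≤ ‖U t ω - V t ω‖ₑ + ‖U' t ω - V' t ω‖ₑ := enorm_sub_le
    _ < ε / 2 + ε / 2 := ENNReal.add_lt_add hcon.1 hcon.2
    _ = ε := ENNReal.add_halves ε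

section Matrix

variable {d : ℕ}

lemma norm_entry_le_frobenius (A : Matrix (Fin d) (Fin d) ℝ) (i j : Fin d) : ‖A i j‖ ≤ ‖A‖ := by
  rw [Matrix.frobenius_norm_def, ← Real.sqrt_eq_rpow]
  refine Real.le_sqrt_of_sq_le ?_
  simp_rw [Real.rpow_two]
  calc ‖A i j‖ ^ 2 ≤ ∑ l, ‖A i l‖ ^ 2 :=
        Finset.single_le_sum (f := fun l => ‖A i l‖ ^ 2) (fun _ _ => by positivity)
          (Finset.mem_univ j)
    _ ≤ _ := Finset.single_le_sum (f := fun k => ∑ l, ‖A k l‖ ^ 2) (fun _ _ => by positivity)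
          (Finset.mem_univ i)

/-- Transfers the entrywise measurability and limits assumed for the matrices to operator-valued
functions. -/
lemma toEuclideanCLM_eq_sum (A : Matrix (Fin d) (Fin d) ℝ) :
    Matrix.toEuclideanCLM (n := Fin d) (𝕜 := ℝ) A
      = ∑ i, ∑ j, A i j • Matrix.toEuclideanCLM (n := Fin d) (𝕜 := ℝ) (Matrix.single i j 1) := by
  conv_lhs => rw [Matrix.matrix_eq_sum_single A]
  simp only [map_sum, ← map_smul, Matrix.smul_single, smul_eq_mul, mul_one]

/-- A singular matrix would have the eigenvalue 0, whose real part is not negative. -/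
lemma IsHurwitz.isUnit_det {A : Matrix (Fin d) (Fin d) ℝ} (hA : IsHurwitz A) :
    IsUnit A.det := by
  rw [isUnit_iff_ne_zero]
  intro h0
  obtain ⟨v, hv0, hv⟩ := Matrix.exists_mulVec_eq_zero_iff.2
    (show (A.map (algebraMap ℝ ℂ)).det = 0 by
      have := (RingHom.map_det (algebraMap ℝ ℂ) A).symm
      rw [h0, map_zero] at this
      exact this)
  have hev : Module.End.HasEigenvalue (Matrix.toLin' (A.map (algebraMap ℝ ℂ))) 0 :=
    Module.End.hasEigenvalue_of_hasEigenvector (x := v)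
      ⟨Module.End.mem_eigenspace_iff.2 (by rw [Matrix.toLin'_apply, hv, zero_smul]), hv0⟩
  simpa using hA 0 hev

lemma lsa_eq_plsa (α : ℕ → ℝ) (A : ℕ → Matrix (Fin d) (Fin d) ℝ)
    (b : ℕ → EuclideanSpace ℝ (Fin d)) (θ₀ : EuclideanSpace ℝ (Fin d)) :
    lsa α A b θ₀ = plsa α (fun _ => 1) A b θ₀ := by
  funext t
  induction t with
  | zero => rfl
  | succ t ih => simp only [lsa, plsa, ih, mul_one]

lemma linearTerm_sub (Abar : Matrix (Fin d) (Fin d) ℝ) (c c' : ℕ → ℝ)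
    (A : ℕ → Matrix (Fin d) (Fin d) ℝ) (b : ℕ → EuclideanSpace ℝ (Fin d))
    (θ : EuclideanSpace ℝ (Fin d)) (t : ℕ) :
    linearTerm Abar (fun n => c n - c' n) A b θ t
      = linearTerm Abar c A b θ t - linearTerm Abar c' A b θ t := by
  simp only [linearTerm, sub_smul, Finset.sum_sub_distrib, map_sub, smul_sub]
  abel

end Matrix

lemma tendsto_integral_sum_smul {Ω ι F : Type*} {mΩ : MeasurableSpace Ω} {P : Measure Ω}
    [NormedAddCommGroup F] [NormedSpace ℝ F]
    [CompleteSpace F] [Fintype ι] {f : ℕ → Ω → ι → ℝ}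
    (hf : ∀ᶠ t in atTop, ∀ i, Integrable (fun ω => f t ω i) P) {c : ι → ℝ}
    (hc : ∀ i, Tendsto (fun t => ∫ ω, f t ω i ∂P) atTop (𝓝 (c i))) (v : ι → F) :
    Tendsto (fun t => ∫ ω, ∑ i, f t ω i • v i ∂P) atTop (𝓝 (∑ i, c i • v i)) := by
  refine (tendsto_finsetSum _ fun i _ => (hc i).smul_const (v i)).congr' ?_
  filter_upwards [hf] with t ht
  rw [integral_finsetSum _ fun i _ => (ht i).smul_const (v i)]
  simp_rw [integral_smul_const]

/-! ### Linear representation of the averaged iterates -/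

section Representation

variable {Ω S : Type*} {mΩ : MeasurableSpace Ω} [MeasurableSpace S] {P : Measure Ω}
  [IsProbabilityMeasure P] {κ : Kernel S S} [IsMarkovKernel κ] {μ : Measure S}
  [IsProbabilityMeasure μ] {X : ℕ → Ω → S} {W : ℕ → Ω → ℝ} {d : ℕ}

/-- Writing `θ_i - θ*` as `Ā⁻¹ Ā (θ_i - θ*)` puts the averaged error and the linear term under one
factor `Ā⁻¹/√t`. -/
lemma sqrt_smul_average_sub {Abar : Matrix (Fin d) (Fin d) ℝ} (hdet : IsUnit Abar.det)
    (θ : ℕ → EuclideanSpace ℝ (Fin d)) (c : ℕ → ℝ) (A : ℕ → Matrix (Fin d) (Fin d) ℝ)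
    (b : ℕ → EuclideanSpace ℝ (Fin d)) (θs : EuclideanSpace ℝ (Fin d)) (t : ℕ) :
    √t • (average θ t - θs) - linearTerm Abar c A b θs t
      = Matrix.toEuclideanCLM (𝕜 := ℝ) Abar⁻¹ ((√t)⁻¹ • ∑ i ∈ Finset.Icc 1 t,
        (Matrix.toEuclideanCLM (𝕜 := ℝ) Abar (θ i - θs)
          + c (i + 1) • (Matrix.toEuclideanCLM (𝕜 := ℝ) (A (i + 1)) θs - b (i + 1)))) := by
  have hinv : ∀ u, Matrix.toEuclideanCLM (𝕜 := ℝ) Abar⁻¹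
      (Matrix.toEuclideanCLM (𝕜 := ℝ) Abar u) = u := fun u => by
    rw [← mul_apply_eq_comp, ← map_mul, Matrix.nonsing_inv_mul _ hdet, map_one]
    rfl
  have hlin : linearTerm Abar c A b θs t = -((√t)⁻¹ • Matrix.toEuclideanCLM (𝕜 := ℝ) Abar⁻¹
      (∑ i ∈ Finset.Icc 1 t,
        c (i + 1) • (Matrix.toEuclideanCLM (𝕜 := ℝ) (A (i + 1)) θs - b (i + 1)))) := rfl
  have hsum : Matrix.toEuclideanCLM (𝕜 := ℝ) Abar⁻¹
      (∑ i ∈ Finset.Icc 1 t, Matrix.toEuclideanCLM (𝕜 := ℝ) Abar (θ i - θs))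
      = ∑ i ∈ Finset.Icc 1 t, θ i - (t : ℝ) • θs := by
    simp_rw [map_sum, hinv, Finset.sum_sub_distrib]
    simp [Nat.cast_smul_eq_nsmul]
  have havg : √t • (average θ t - θs) = (√t)⁻¹ • (∑ i ∈ Finset.Icc 1 t, θ i - (t : ℝ) • θs) := by
    -- At `t = 0` both sides vanish, because `√0` and its inverse are 0.
    rcases Nat.eq_zero_or_pos t with rfl | ht
    · simp
    have ht' : (0 : ℝ) < t := by exact_mod_cast ht
    have hs := Real.sqrt_pos.2 ht'
    rw [average, smul_sub, smul_sub, smul_smul, smul_smul]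
    congr 2
    · nth_rw 2 [← Real.mul_self_sqrt ht'.le]
      field_simp
    · nth_rw 3 [← Real.mul_self_sqrt ht'.le]
      field_simp
  rw [hlin, Finset.sum_add_distrib, smul_add, map_add, map_smul, map_smul, hsum, havg]
  abel

/-- The averaged error minus the linear term is `Ā⁻¹/√t` applied to the sums controlled by
`tendsto_integral_norm`, hence tends to 0 in `L¹` and so in probability. -/
theorem plsa_representation (hergodic : UniformlyErgodic κ μ) (hX : IsMarkovChain P κ X)
    (hW : IsMeanOneWeights P X W)
    {A : S → Matrix (Fin d) (Fin d) ℝ} {b : S → EuclideanSpace ℝ (Fin d)}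
    (hA_meas : ∀ i j, Measurable fun x => A x i j) (hb_meas : Measurable b)
    {Abar : Matrix (Fin d) (Fin d) ℝ} {bbar : EuclideanSpace ℝ (Fin d)}
    (hAbar : ∀ i j, Tendsto (fun t : ℕ => ∫ ω, A (X t ω) i j ∂P) atTop (𝓝 (Abar i j)))
    (hbbar : Tendsto (fun t : ℕ => ∫ ω, b (X t ω) ∂P) atTop (𝓝 bbar))
    (hHurwitz : IsHurwitz Abar) {Amax bmax : ℝ} (hAmax : ∀ x, ‖A x‖ ≤ Amax)
    (hbmax : ∀ x, ‖b x‖ ≤ bmax) {α : ℕ → ℝ} (hα : IsSlowlyDecreasing α)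
    {θs : EuclideanSpace ℝ (Fin d)} (hθs : Matrix.toEuclideanLin Abar θs = bbar)
    (θ₀ : EuclideanSpace ℝ (Fin d)) :
    EqUpToLittleOp P
      (fun t ω => √t • (average (plsa α (fun n => W n ω)
          (fun n => A (X n ω)) (fun n => b (X n ω)) θ₀) t - θs))
      (fun t ω => linearTerm Abar (fun n => W n ω)
        (fun n => A (X n ω)) (fun n => b (X n ω)) θs t) := by
  set A' : S → EuclideanSpace ℝ (Fin d) →L[ℝ] EuclideanSpace ℝ (Fin d) :=
    fun x => Matrix.toEuclideanCLM (𝕜 := ℝ) (A x) with hA'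
  set T := Matrix.toEuclideanCLM (n := Fin d) (𝕜 := ℝ) Abar with hT
  set V : Fin d × Fin d → EuclideanSpace ℝ (Fin d) →L[ℝ] EuclideanSpace ℝ (Fin d) :=
    fun p => Matrix.toEuclideanCLM (n := Fin d) (𝕜 := ℝ) (Matrix.single p.1 p.2 1) with hV
  have hexp : ∀ B : Matrix (Fin d) (Fin d) ℝ, Matrix.toEuclideanCLM (n := Fin d) (𝕜 := ℝ) B
      = ∑ p : Fin d × Fin d, B p.1 p.2 • V p := fun B => by
    rw [toEuclideanCLM_eq_sum, Fintype.sum_prod_type]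
  have hA'm : StronglyMeasurable A' := by
    simp only [hA', hexp]
    exact Finset.stronglyMeasurable_fun_sum _ fun p _ =>
      (hA_meas p.1 p.2).stronglyMeasurable.smul_const _
  have hA'b : ∀ x, ‖A' x‖ ≤ ∑ p, Amax * ‖V p‖ := fun x => by
    simp only [hA', hexp]
    refine norm_sum_le_of_le _ fun p _ => ?_
    rw [norm_smul]
    gcongr
    exact (norm_entry_le_frobenius _ _ _).trans (hAmax x)
  have hA'lim : Tendsto (fun t : ℕ => ∫ ω, A' (X t ω) ∂P) atTop (𝓝 T) := by
    simp only [hA', hT, hexp]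
    refine tendsto_integral_sum_smul (f := fun t ω (p : Fin d × Fin d) => A (X t ω) p.1 p.2)
      ?_ (fun p => hAbar p.1 p.2) V
    filter_upwards [eventually_ge_atTop 1] with t ht p
    exact Integrable.of_bound ((hA_meas p.1 p.2).comp (hX.measurable t ht)).aestronglyMeasurable
      Amax (ae_of_all _ fun ω => (norm_entry_le_frobenius _ _ _).trans (hAmax _))
  -- The noise at the target; its limiting mean is `Ā θ* - b̄ = 0`.
  set ξ : S → EuclideanSpace ℝ (Fin d) := fun x => A' x θs - b x with hξ
  have hξm : StronglyMeasurable ξ :=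
    ((ContinuousLinearMap.apply ℝ _ θs).continuous.comp_stronglyMeasurable hA'm).sub hb_meas.stronglyMeasurable
  have hξb : ∀ x, ‖ξ x‖ ≤ (∑ p, Amax * ‖V p‖) * ‖θs‖ + bmax := fun x =>
    (norm_sub_le _ _).trans (add_le_add ((A' x).le_of_opNorm_le (hA'b x) θs) (hbmax x))
  have hξlim : Tendsto (fun t : ℕ => ∫ ω, ξ (X t ω) ∂P) atTop (𝓝 0) := by
    have h0 : T θs - bbar = 0 := sub_eq_zero.2 hθs
    rw [← h0]
    have h1 := (((ContinuousLinearMap.apply ℝ (EuclideanSpace ℝ (Fin d)) θs).continuous.tendsto T).comp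
      hA'lim).sub hbbar
    refine h1.congr' ?_
    filter_upwards [eventually_ge_atTop 1] with t ht
    have hi : Integrable (fun ω => A' (X t ω)) P :=
      Integrable.of_bound (hA'm.comp_measurable (hX.measurable t ht)).aestronglyMeasurable _
        (ae_of_all _ fun ω => hA'b _)
    have hi' : Integrable (fun ω => b (X t ω)) P :=
      Integrable.of_bound (hb_meas.comp (hX.measurable t ht)).aestronglyMeasurable _
        (ae_of_all _ fun ω => hbmax _)
    simp only [hξ]
    rw [integral_sub (hi.apply_continuousLinearMap θs) hi',
      ← ContinuousLinearMap.integral_apply hi]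
    rfl
  obtain ⟨M, H, C₁, hMH, hopdec⟩ := exists_noise_decomposition hergodic hX hW hA'm hA'b hA'lim
  obtain ⟨m, h, C₂, hmh, hvecdec⟩ := exists_noise_decomposition hergodic hX hW hξm hξb hξlim
  set e : ℕ → Ω → EuclideanSpace ℝ (Fin d) := fun t ω => plsa α (fun n => W n ω)
          (fun n => A (X n ω)) (fun n => b (X n ω)) θ₀ t - θs with he
  have hestep : ∀ t ω, e (t + 1) ω = e t ω
      + α (t + 1) • (W (t + 1) ω • A' (X (t + 1) ω) (e t ω) + W (t + 1) ω • ξ (X (t + 1) ω)) := by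
    intro t ω
    have h1 : plsa α (fun n => W n ω) (fun n => A (X n ω)) (fun n => b (X n ω)) θ₀ (t + 1)
        = plsa α (fun n => W n ω) (fun n => A (X n ω)) (fun n => b (X n ω)) θ₀ t
          + (α (t + 1) * W (t + 1) ω) • (A' (X (t + 1) ω) (plsa α (fun n => W n ω)
            (fun n => A (X n ω)) (fun n => b (X n ω)) θ₀ t) - b (X (t + 1) ω)) := rfl
    simp only [he, hξ, h1, map_sub]
    module
  have hX1 : Measurable[jointHistory X W 1] (X 1) :=
    (measurable_history X le_rfl).mono le_sup_left le_rfl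
  have hW1 : IsBddMeas P (jointHistory X W 1) (W 1) := by
    obtain ⟨B, hB⟩ := hW.bounded
    have hWm : Measurable[jointHistory X W 1] (W 1) :=
      (measurable_history W le_rfl).mono le_sup_right le_rfl
    exact ⟨hWm.stronglyMeasurable, B, hB 1 le_rfl⟩
  have hrec : IsErrorRecursion P (jointHistory X W) α T (max 0 (max C₁ C₂)) M H m h e := by
    refine ⟨fun t => sup_le (history_le hX.measurable t) (history_le hW.measurable t),
      jointHistory_mono X W, le_max_left _ _,
      hMH.mono (le_max_of_le_right (le_max_left _ _)),
      hmh.mono (le_max_of_le_right (le_max_right _ _)), ?_, fun t ht ω => ?_⟩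
    -- Since `X 0` is unspecified, the error recursion starts at time one; `e 1` is computed from
    -- the deterministic initial value.
    · have hA1 : IsBddMeas P (jointHistory X W 1) (fun ω => A' (X 1 ω)) :=
        ⟨hA'm.comp_measurable hX1, _, ae_of_all _ fun ω => hA'b _⟩
      have hξ1 : IsBddMeas P (jointHistory X W 1) (fun ω => ξ (X 1 ω)) :=
        ⟨hξm.comp_measurable hX1, _, ae_of_all _ fun ω => hξb _⟩
      have h0 : e 1 = fun ω => (θ₀ - θs)
          + α 1 • (W 1 ω • A' (X 1 ω) (θ₀ - θs) + W 1 ω • ξ (X 1 ω)) :=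
        funext fun ω => hestep 0 ω
      rw [h0]
      exact (IsBddMeas.const _).add
        (((hW1.smul (hA1.clm_apply (IsBddMeas.const _))).add (hW1.smul hξ1)).const_smul _)
    · rw [hestep, hvecdec t ht ω, ← smul_apply, hopdec t ht ω]
      simp only [add_apply]
      congr 2
      abel
  obtain ⟨Q, c, hQ⟩ := exists_isLyapunov_of_isHurwitz hHurwitz
  have hlim := hrec.tendsto_integral_norm hα hQ
  set U : ℕ → Ω → EuclideanSpace ℝ (Fin d) := fun t ω =>
    ∑ i ∈ Finset.Icc 1 t, (T (e i ω) + m i ω + (h i ω - h (i + 1) ω)) with hU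
  set L := Matrix.toEuclideanCLM (n := Fin d) (𝕜 := ℝ) Abar⁻¹ with hL
  have hdiff : ∀ t : ℕ, (fun ω => √t • (average (plsa α (fun n => W n ω)
          (fun n => A (X n ω)) (fun n => b (X n ω)) θ₀) t - θs)
      - linearTerm Abar (fun n => W n ω) (fun n => A (X n ω)) (fun n => b (X n ω)) θs t)
      = fun ω => L ((√t)⁻¹ • U t ω) := by
    intro t
    funext ω
    rw [sqrt_smul_average_sub hHurwitz.isUnit_det]
    simp only [hL, hU]
    congr 2
    refine Finset.sum_congr rfl fun i hi => ?_
    have h1 : W (i + 1) ω • (Matrix.toEuclideanCLM (𝕜 := ℝ) (A (X (i + 1) ω)) θs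
        - b (X (i + 1) ω)) = 0 + m i ω + (h i ω - h (i + 1) ω) :=
      hvecdec i (Finset.mem_Icc.1 hi).1 ω
    -- The sample `i + 1` in the linear term is the one that drives the step from `θ_i`, so its
    -- decomposition matches the summand with `e i`; the 0 is the mean of `ξ`.
    rw [h1, zero_add, add_assoc]
  have hUm : ∀ t, IsBddMeas P (jointHistory X W (t + 1)) (U t) := fun t =>
    IsBddMeas.sum fun i hi => by
      have hi' := Finset.mem_Icc.1 hi
      have m1 : jointHistory X W i ≤ jointHistory X W (t + 1) :=
        jointHistory_mono X W (by omega)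
      have m2 : jointHistory X W (i + 1) ≤ jointHistory X W (t + 1) :=
        jointHistory_mono X W (by omega)
      exact ((((hrec.bddMeas_e hi'.1).clm_comp T).mono m1).add
        ((hrec.bddMeas_m hi'.1).mono m2)).add (((hrec.bddMeas_h hi'.1).mono m1).sub
          ((hrec.bddMeas_h (by omega)).mono m2))
  have hDm : ∀ t : ℕ, IsBddMeas P (jointHistory X W (t + 1)) (fun ω => L ((√t)⁻¹ • U t ω)) :=
    fun t => ((hUm t).const_smul _).clm_comp L
  refine TendstoInMeasure.congr_left
    (fun t => ae_of_all _ fun ω => (congrFun (hdiff t) ω).symm) ?_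
  refine tendstoInMeasure_of_tendsto_eLpNorm one_ne_zero
    (fun t => ((hDm t).integrable (hrec.le _)).aestronglyMeasurable)
    aestronglyMeasurable_zero ?_
  have hnorm : ∀ t : ℕ, eLpNorm ((fun ω => L ((√t)⁻¹ • U t ω)) - fun _ => 0) 1 P
      ≤ ENNReal.ofReal (‖L‖ * ((√t)⁻¹ * ∫ ω, ‖U t ω‖ ∂P)) := by
    intro t
    have hi := (hDm t).integrable (hrec.le _)
    have hsub : ((fun ω => L ((√t)⁻¹ • U t ω)) - fun _ => (0 : EuclideanSpace ℝ (Fin d)))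
        = fun ω => L ((√t)⁻¹ • U t ω) := by ext1 ω; simp
    rw [hsub, eLpNorm_one_eq_lintegral_enorm, ← ofReal_integral_norm_eq_lintegral_enorm hi]
    refine ENNReal.ofReal_le_ofReal ?_
    rw [← integral_const_mul, ← integral_const_mul]
    refine integral_mono hi.norm ((((hUm t).norm.integrable (hrec.le _)).const_mul _).const_mul _)
      fun ω => ?_
    refine (L.le_opNorm _).trans (le_of_eq ?_)
    rw [norm_smul, norm_inv, Real.norm_of_nonneg (Real.sqrt_nonneg _)]
  refine tendsto_of_tendsto_of_tendsto_of_le_of_le tendsto_const_nhds ?_ (fun _ => zero_le)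
    hnorm
  have := ENNReal.tendsto_ofReal (hlim.const_mul ‖L‖)
  simpa using this

end Representation

end LSA

/-! ### The three expansions -/

theorem mainTheorem5 {Ω S : Type*} [MeasurableSpace Ω] [MeasurableSpace S]
    (P : Measure Ω) [IsProbabilityMeasure P]
    -- the Markov chain
    (κ : Kernel S S) [IsMarkovKernel κ] (μ : Measure S) [IsProbabilityMeasure μ]
    (hergodic : LSA.UniformlyErgodic κ μ)
    (X : ℕ → Ω → S) (hX : LSA.IsMarkovChain P κ X)
    -- the observations
    (d : ℕ) (A : S → Matrix (Fin d) (Fin d) ℝ) (b : S → EuclideanSpace ℝ (Fin d))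
    (hA_meas : ∀ i j, Measurable fun x => A x i j) (hb_meas : Measurable b)
    (Abar : Matrix (Fin d) (Fin d) ℝ) (bbar : EuclideanSpace ℝ (Fin d))
    (hAbar : ∀ i j, Tendsto (fun t : ℕ => ∫ ω, A (X t ω) i j ∂P) atTop (𝓝 (Abar i j)))
    (hbbar : Tendsto (fun t : ℕ => ∫ ω, b (X t ω) ∂P) atTop (𝓝 bbar))
    (hHurwitz : LSA.IsHurwitz Abar)
    (Amax bmax : ℝ) (hAmax : ∀ x, ‖A x‖ ≤ Amax) (hbmax : ∀ x, ‖b x‖ ≤ bmax)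
    -- the step sizes
    (α₀ η : ℝ) (hα₀ : 0 < α₀) (hη : η ∈ Set.Ioo (1 / 2 : ℝ) 1)
    -- the target
    (θs : EuclideanSpace ℝ (Fin d)) (hθs : Matrix.toEuclideanLin Abar θs = bbar) :
    -- representation of the perturbed average
    (∀ W : ℕ → Ω → ℝ, LSA.IsBootstrapWeights P X W → ∀ θhat₀ : EuclideanSpace ℝ (Fin d),
      LSA.EqUpToLittleOp P
        (fun t ω => Real.sqrt t •
          (LSA.average (LSA.plsa (LSA.stepSize α₀ η) (fun n => W n ω)
            (fun n => A (X n ω)) (fun n => b (X n ω)) θhat₀) t - θs))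
        (fun t ω => LSA.linearTerm Abar (fun n => W n ω)
          (fun n => A (X n ω)) (fun n => b (X n ω)) θs t)) ∧
    -- representation of the unperturbed average
    (∀ θ₀ : EuclideanSpace ℝ (Fin d),
      LSA.EqUpToLittleOp P
        (fun t ω => Real.sqrt t •
          (LSA.average (LSA.lsa (LSA.stepSize α₀ η)
            (fun n => A (X n ω)) (fun n => b (X n ω)) θ₀) t - θs))
        (fun t ω => LSA.linearTerm Abar (fun _ => 1)
          (fun n => A (X n ω)) (fun n => b (X n ω)) θs t)) ∧
    -- representation of the bootstrap difference
    (∀ W : ℕ → Ω → ℝ, LSA.IsBootstrapWeights P X W →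
      ∀ θhat₀ θ₀ : EuclideanSpace ℝ (Fin d),
      LSA.EqUpToLittleOp P
        (fun t ω => Real.sqrt t •
          (LSA.average (LSA.plsa (LSA.stepSize α₀ η) (fun n => W n ω)
              (fun n => A (X n ω)) (fun n => b (X n ω)) θhat₀) t
            - LSA.average (LSA.lsa (LSA.stepSize α₀ η)
              (fun n => A (X n ω)) (fun n => b (X n ω)) θ₀) t))
        (fun t ω => LSA.linearTerm Abar (fun n => W n ω - 1)
          (fun n => A (X n ω)) (fun n => b (X n ω)) θs t)) := by
  have hα := LSA.isSlowlyDecreasing_stepSize hα₀ hη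
  have hperturbed : ∀ W : ℕ → Ω → ℝ, LSA.IsBootstrapWeights P X W →
      ∀ θhat₀ : EuclideanSpace ℝ (Fin d), _ := fun W hW θhat₀ =>
    LSA.plsa_representation hergodic hX hW.isMeanOneWeights hA_meas hb_meas hAbar hbbar hHurwitz
      hAmax hbmax hα hθs θhat₀
  have hplain : ∀ θ₀ : EuclideanSpace ℝ (Fin d), LSA.EqUpToLittleOp P
      (fun t ω => Real.sqrt t • (LSA.average (LSA.lsa (LSA.stepSize α₀ η)
          (fun n => A (X n ω)) (fun n => b (X n ω)) θ₀) t - θs))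
      (fun t ω => LSA.linearTerm Abar (fun _ => 1)
        (fun n => A (X n ω)) (fun n => b (X n ω)) θs t) := fun θ₀ => by
    simp_rw [LSA.lsa_eq_plsa]
    exact LSA.plsa_representation hergodic hX LSA.isMeanOneWeights_one hA_meas hb_meas hAbar hbbar
      hHurwitz hAmax hbmax hα hθs θ₀
  refine ⟨hperturbed, hplain, fun W hW θhat₀ θ₀ => ?_⟩
  -- Subtracting the two expansions cancels `θ*` and turns the weights `W` and `1` into `W - 1`.
  have hsub := (hperturbed W hW θhat₀).sub (hplain θ₀)
  simp_rw [← LSA.linearTerm_sub, ← smul_sub, sub_sub_sub_cancel_right] at hsub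
  exact hsub
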